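/- Let $n\ge 1$ and $\tfrac12<\alpha<1$. Let $S(t)=e^{-t(-\Delta)^\alpha}$ be the fractional heat semigroup on $\mathbb R^n$, where $(-\Delta)^\alpha$ has Fourier symbol $|\xi|^{2\alpha}$, and let $\Pi$ be the Leray projection, with symbol $\delta_{ij}-\xi_i\xi_j/|\xi|^2$. Let $\mathcal B=\dot B^{1-2\alpha,\infty}_\infty(\mathbb R^n)$ be the homogeneous Besov space of those tempered distributions $v$ with $\lim_{\lambda\to\infty}\|\theta(\lambda D)v\|_{L^\infty}=0$ for all $\theta\in C_c^\infty(\mathbb R^n)$ for which $$\|v\|_{\dot B^{1-2\alpha,\infty}_\infty}=\sup_{j\in\mathbb Z}2^{j(1-2\alpha)}\|P_jv\|_{L^\infty}<\infty,$$ where the $P_j$ are the blocks of a fixed homogeneous Littlewood–Paley decomposition. Write also $$\|v\|_{\mathcal E}=\sup_{x\in\mathbb R^n,\,R>0}\Big(R^{-(n+2-2\alpha)}\int_0^{R^{2\alpha}}\!\!\int_{B(x,R)}|S(t)v(y)|^2\,dy\,dt\Big)^{1/2},\qquad \|u\|_{GX}=\sup_{t>0}t^{1-\frac1{2\alpha}}\|u(t)\|_{L^\infty(\mathbb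 R^n)} .$$ There is a constant $C$, depending only on $n$, $\alpha$ and the Littlewood–Paley decomposition, such that the following holds. Let $u_0\in\mathcal B^n$ with $\nabla\cdot u_0=0$, and let $u:\mathbb R^n\times(0,\infty)\to\mathbb R^n$ be measurable with $\|u\|_{GX}<\infty$ and be a global mild solution, with initial data $u_0$, of the generalized Navier–Stokes equations $$u_t+(u\cdot\nabla)u+(-\Delta)^\alpha u+\nabla p=0,\qquad \nabla\cdot u=0,\qquad u(0)=u_0,$$ that is, for all $t>0$, $$u(t)=S(t)u_0-\int_0^tS(t-s)\,\Pi\nabla\cdot(u\otimes u)(s)\,ds$$ (for instance the unique small solution that exists when $u_0$ is small). Then for every fixed $t_0>0$ each component of $u(\cdot,t_0)$ belongs to $\mathcal B$, and both its $\dot B^{1-2\alpha,\infty}_\infty$ norm and its $\mathcal E$ norm are at most $$C\left(\|u\|_{GX}+\|u\|_{GX}^2\right).$$ -/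

import Mathlib

open MeasureTheory Filter Topology SchwartzMap FourierTransform LineDeriv
open scoped NNReal ENNReal

noncomputable section

namespace FracNS

/-- The Euclidean space `ℝⁿ`. -/
abbrev Sp (n : ℕ) : Type := EuclideanSpace ℝ (Fin n)

variable {n : ℕ}

/-! ### Homogeneous Besov spaces through a Littlewood-Paley decomposition -/

/-- `f` is a function representing the tempered distribution `v`. -/
def Represents (f : Sp n → ℂ) (v : 𝓢'(Sp n, ℂ)) : Prop :=
  ∀ φ : 𝓢(Sp n, ℂ), Integrable (fun x => φ x * f x) ∧ v φ = ∫ x, φ x * f x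

/-- The `L^∞` norm of a tempered distribution: the essential supremum of the function that
represents it, and `∞` if it is not represented by an essentially bounded function. -/
def linftyNorm (v : 𝓢'(Sp n, ℂ)) : ℝ≥0∞ :=
  ⨅ (f : Sp n → ℂ) (_ : MemLp f ⊤ volume ∧ Represents f v), eLpNorm f ⊤ volume

/-- A homogeneous dyadic partition of unity: a smooth function supported in a compact set that
does not contain the origin, whose dyadic dilates sum to `1` away from the origin. -/
structure IsDyadicPartition (ψ : Sp n → ℂ) : Prop where
  smooth : ContDiff ℝ (⊤ : ℕ∞) ψ
  compact_support : HasCompactSupport ψ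
  zero_notMem : (0 : Sp n) ∉ tsupport ψ
  sum_eq_one : ∀ ξ : Sp n, ξ ≠ 0 → HasSum (fun j : ℤ => ψ ((2 : ℝ) ^ (-j) • ξ)) 1

/-- The dyadic block `P_j v = ψ(2^{-j} D) v`. -/
def dyadicBlock (ψ : Sp n → ℂ) (j : ℤ) (v : 𝓢'(Sp n, ℂ)) : 𝓢'(Sp n, ℂ) :=
  TemperedDistribution.fourierMultiplierCLM ℂ (fun ξ : Sp n => ψ ((2 : ℝ) ^ (-j) • ξ)) v

/-- The space `𝓢'_h` of tempered distributions `v` with `‖θ(λ D) v‖_{L^∞} → 0` as `λ → ∞`, for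
every smooth compactly supported `θ`. -/
def VanishesAtLowFrequency (v : 𝓢'(Sp n, ℂ)) : Prop :=
  ∀ θ : Sp n → ℂ, ContDiff ℝ (⊤ : ℕ∞) θ → HasCompactSupport θ →
    Tendsto (fun l : ℝ => linftyNorm
      (TemperedDistribution.fourierMultiplierCLM ℂ (fun ξ : Sp n => θ (l • ξ)) v)) atTop (𝓝 0)

/-- The norm of `Ḃ^{σ,∞}_∞`: the supremum over `j ∈ ℤ` of `2^{jσ} ‖P_j v‖_{L^∞}`. -/
def besovNorm (ψ : Sp n → ℂ) (σ : ℝ) (v : 𝓢'(Sp n, ℂ)) : ℝ≥0∞ :=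
  ⨆ j : ℤ, ENNReal.ofReal ((2 : ℝ) ^ ((j : ℝ) * σ)) * linftyNorm (dyadicBlock ψ j v)

/-- Membership in the homogeneous Besov space `Ḃ^{σ,∞}_∞`. -/
def MemBesov (ψ : Sp n → ℂ) (σ : ℝ) (v : 𝓢'(Sp n, ℂ)) : Prop :=
  VanishesAtLowFrequency v ∧ besovNorm ψ σ v < ⊤

/-! ### The fractional heat semigroup -/

/-- The Fourier symbol `exp (-t |η|^{2α})` of `S(t) = exp (-t (-Δ)^α)` at the angular frequency
`η = 2πξ`. -/
def heatSymbol (α t : ℝ) (ξ : Sp n) : ℝ :=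
  Real.exp (-t * (2 * Real.pi * ‖ξ‖) ^ (2 * α))

/-- The kernel `Φ(t, ·)` of `S(t)`. -/
def heatKernel (α t : ℝ) : Sp n → ℂ :=
  𝓕⁻ (fun ξ : Sp n => (heatSymbol α t ξ : ℂ))

/-- `g(t) = S(t) v` for all `t > 0`. The distribution `S(t) v = Φ(t, ·) * v` is the one whose value
at `φ` is the integral of `Φ(t, z)` against `⟨v, φ(· - z)⟩`. -/
def IsHeatFlow (α : ℝ) (v : 𝓢'(Sp n, ℂ)) (g : ℝ → Sp n → ℂ) : Prop :=
  ∀ t : ℝ, 0 < t → ∀ φ : 𝓢(Sp n, ℂ),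
    Integrable (fun z : Sp n => heatKernel α t z * v (compSubConstCLM ℂ z φ)) ∧
    Integrable (fun x : Sp n => φ x * g t x) ∧
    ∫ x, φ x * g t x = ∫ z : Sp n, heatKernel α t z * v (compSubConstCLM ℂ z φ)

/-- The norm of the space `𝓔`: the supremum over `x` and `R > 0` of
`(R^{-(n+2-2α)} ∫_{B(x,R) × (0,R^{2α})} |S(t) v(y)|² dt dy)^{1/2}`, and `∞` if `S(t) v` is not a
function. -/
def carlesonNorm (α : ℝ) (v : 𝓢'(Sp n, ℂ)) : ℝ≥0∞ :=
  ⨅ (g : ℝ → Sp n → ℂ) (_ : IsHeatFlow α v g), ⨆ (x : Sp n) (R : ℝ) (_ : 0 < R),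
    (ENNReal.ofReal (R ^ (-((n : ℝ) + 2 - 2 * α))) *
      ∫⁻ t in Set.Ioo 0 (R ^ (2 * α)), ∫⁻ y in Metric.ball x R, ‖g t y‖ₑ ^ 2) ^ (1 / 2 : ℝ)

/-! ### The space `GX` and mild solutions -/

/-- The norm of `GX`: the supremum over `t > 0` of `t^{1 - 1/(2α)} ‖u(t)‖_{L^∞}`. -/
def gxNorm (α : ℝ) (u : ℝ → Sp n → Sp n) : ℝ≥0∞ :=
  ⨆ (t : ℝ) (_ : 0 < t), ENNReal.ofReal (t ^ (1 - 1 / (2 * α))) * eLpNorm (u t) ⊤ volume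

/-- Membership in `GX` of a vector field on `ℝⁿ × (0, ∞)`. -/
structure MemGX (α : ℝ) (u : ℝ → Sp n → Sp n) : Prop where
  aesm : AEStronglyMeasurable (Function.uncurry u)
    ((volume.restrict (Set.Ioi (0 : ℝ))).prod volume)
  aesm_slice : ∀ t : ℝ, 0 < t → AEStronglyMeasurable (u t) volume
  norm_lt_top : gxNorm α u < ⊤

/-- The symbol `δ_{ij} - ξ_i ξ_j / |ξ|²` of the Leray projection `Π`. -/
def leraySymbol (i j : Fin n) (ξ : Sp n) : ℝ :=
  (if i = j then 1 else 0) - ξ i * ξ j / ‖ξ‖ ^ 2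

/-- The kernel of `Π_{ij} ∂_k S(τ)`. -/
def projKernel (α : ℝ) (i j k : Fin n) (τ : ℝ) : Sp n → ℂ :=
  𝓕⁻ (fun ξ : Sp n =>
    (2 * Real.pi * Complex.I * (ξ k : ℂ)) * (leraySymbol i j ξ : ℂ) * (heatSymbol α τ ξ : ℂ))

/-- The `i`-th component of `V ∇ Π N(u)` with `N(u) = u ⊗ u`, that is, of
`∫₀ᵗ S(t-s) Π ∇·(u ⊗ u)(s) ds`. -/
def duhamel (α : ℝ) (u : ℝ → Sp n → Sp n) (i : Fin n) (t : ℝ) (x : Sp n) : ℂ :=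
  ∫ s in Set.Ioo 0 t, ∫ y : Sp n, ∑ j : Fin n, ∑ k : Fin n,
    projKernel α i j k (t - s) (x - y) * ((u s y j : ℂ) * (u s y k : ℂ))

/-- `u` solves `u(t) = S(t) u₀ - V ∇ Π N(u) (t)` for all `t > 0`: componentwise,
`u(t) + V ∇ Π N(u) (t)` is the fractional heat flow of `u₀`. -/
def IsMildSolution (α : ℝ) (u₀ : Fin n → 𝓢'(Sp n, ℂ)) (u : ℝ → Sp n → Sp n) : Prop :=
  ∀ i : Fin n, IsHeatFlow α (u₀ i) (fun t x => (u t x i : ℂ) + duhamel α u i t x)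

/-- The divergence of a vector of tempered distributions. -/
def divergence (v : Fin n → 𝓢'(Sp n, ℂ)) : 𝓢'(Sp n, ℂ) :=
  ∑ i : Fin n, ∂_{(EuclideanSpace.single i (1 : ℝ) : Sp n)} (v i)

end FracNS

end

noncomputable section

namespace FracNS

section

open Set unitInterval

/-! ### The one-sided stable law -/

/-! Put β = 1 - 1/(2α) and let D(t) be the Duhamel integral, so that u(t) + D(t) = S(t)u₀. Applying
S(t) at time t₀ and using S(t)S(t₀) = S(t + t₀) eliminates u₀: S(t)u(t₀) = u(t + t₀) + D(t + t₀) -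
S(t)D(t₀). The last term is the Duhamel integral over (0, t₀) observed at time t + t₀. The L¹ norm
of the kernel of Π∂S(τ) is O(τ^(-1/(2α))), and |u ⊗ u|(s) is O(s^(-2β)). Since 1/(2α) < 1 and 2β <
1, the integral of (T - s)^(-1/(2α)) s^(-2β) over (0, T) converges and is O(T^(-β)). Hence S(t)u(t₀)
= O(t^(-β)), uniformly in t₀, with constant of order M + M², where M is the `GX` norm
(`norm_heat_mild_le`).

Everything else follows from this decay. A dyadic block factors as P_j = a(2^(-j)D) S(2^(-2αj)) with
a smooth and compactly supported, giving `besovNorm_le`. Squaring and integrating t^(-2β) over a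
cylinder gives `carlesonNorm_le`. For low frequencies, split f = S(t)f + (f - S(t)f): the first part
is small for t large, and θ(λD) makes the second small as λ → ∞ with t fixed
(`vanishesAtLowFrequency`).

The kernel facts rest on subordination. The one-sided α-stable law (`exists_stable_subordinator`)
writes exp(-t|η|^(2α)) as an average of Gaussians, so the heat kernel is positive and integrable
(`heatKernel_spec`). Averaging the Gaussian case likewise yields the L¹ bound for the projected
gradient (`projKernel_spec`). Positivity also supplies the Fubini argument behind the semigroup law
for flows of distributions (`IsHeatFlow.cv_ae_eq`). -/

lemma integrableOn_levy {α l : ℝ} (hα : 0 < α) (hα' : α < 1) (hl : 0 < l) :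
    IntegrableOn (fun x : ℝ => (1 - Real.exp (-l * x)) * (α * x ^ (-(α + 1)))) (Ioi 0) := by
  have hm : Measurable (fun x : ℝ => (1 - Real.exp (-l * x)) * (α * x ^ (-(α + 1)))) := by
    fun_prop
  rw [← Ioc_union_Ioi_eq_Ioi (zero_le_one (α := ℝ))]
  refine IntegrableOn.union ?_ ?_
  · have h : IntegrableOn (fun x : ℝ => l * α * x ^ (-α)) (Ioc 0 1) := by
      have := (intervalIntegral.intervalIntegrable_rpow' (a := 0) (b := 1) (r := -α)
        (by linarith)).const_mul (l * α)
      rwa [intervalIntegrable_iff_integrableOn_Ioc_of_le zero_le_one] at this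
    refine Integrable.mono' h hm.aestronglyMeasurable ?_
    refine (ae_restrict_iff' measurableSet_Ioc).2 (.of_forall fun x hx => ?_)
    have hx0 : 0 < x := hx.1
    have h1 : 1 - Real.exp (-l * x) ≤ l * x := by
      have := Real.add_one_le_exp (-l * x); linarith
    have h2 : 0 ≤ 1 - Real.exp (-l * x) := by
      have : Real.exp (-l * x) ≤ 1 := Real.exp_le_one_iff.2 (by nlinarith)
      linarith
    rw [Real.norm_of_nonneg (by positivity)]
    calc _ ≤ (l * x) * (α * x ^ (-(α + 1))) := by gcongr
      _ = l * α * (x * x ^ (-(α + 1))) := by ring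
      _ = _ := by
        congr 1
        nth_rw 1 [← Real.rpow_one x]
        rw [← Real.rpow_add hx0]; congr 1; ring
  · have h : IntegrableOn (fun x : ℝ => α * x ^ (-(α + 1))) (Ioi 1) :=
      (integrableOn_Ioi_rpow_of_lt (by linarith) one_pos).const_mul α
    refine Integrable.mono' h hm.aestronglyMeasurable ?_
    refine (ae_restrict_iff' measurableSet_Ioi).2 (.of_forall fun x hx => ?_)
    have hx0 : 0 < x := one_pos.trans hx
    have h2 : 0 ≤ 1 - Real.exp (-l * x) := by
      have : Real.exp (-l * x) ≤ 1 := Real.exp_le_one_iff.2 (by nlinarith)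
      linarith
    have h3 : 1 - Real.exp (-l * x) ≤ 1 := by linarith [Real.exp_pos (-l * x)]
    rw [Real.norm_of_nonneg (by positivity)]
    exact mul_le_of_le_one_left (by positivity) h3

/-- The Laplace exponent at `1` of the (unnormalised) stable Lévy measure. -/
def levyConst (α : ℝ) : ℝ := ∫ x in Ioi (0 : ℝ), (1 - Real.exp (-1 * x)) * (α * x ^ (-(α + 1)))

/-- The substitution x ↦ l x: homogeneity of the Lévy density is the source of the exponent l ^ α.
-/
lemma integral_levy {α l : ℝ} (hl : 0 < l) :
    ∫ x in Ioi (0 : ℝ), (1 - Real.exp (-l * x)) * (α * x ^ (-(α + 1))) =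
      levyConst α * l ^ α := by
  have h := integral_comp_mul_left_Ioi
    (fun x : ℝ => (1 - Real.exp (-1 * x)) * (α * x ^ (-(α + 1)))) 0 hl
  rw [mul_zero, smul_eq_mul] at h
  have h2 : levyConst α * l ^ α = l ^ (α + 1) * (l⁻¹ * levyConst α) := by
    rw [Real.rpow_add hl, Real.rpow_one]; field_simp
  rw [h2, levyConst, ← h, ← integral_const_mul]
  refine setIntegral_congr_fun measurableSet_Ioi fun x hx => ?_
  have hx0 : 0 < x := hx
  rw [Real.mul_rpow hl.le hx0.le]
  have : l ^ (α + 1) * l ^ (-(α + 1)) = 1 := by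
    rw [← Real.rpow_add hl]; simp
  calc _ = (l ^ (α + 1) * l ^ (-(α + 1))) * ((1 - Real.exp (-l * x)) * (α * x ^ (-(α + 1)))) := by
        rw [this, one_mul]
    _ = _ := by rw [show -1 * (l * x) = -l * x by ring]; ring

lemma levyConst_pos {α : ℝ} (hα : 0 < α) (hα' : α < 1) : 0 < levyConst α := by
  rw [levyConst, setIntegral_pos_iff_support_of_nonneg_ae]
  · have : Ioi (0 : ℝ) ⊆ (Function.support fun x : ℝ =>
        (1 - Real.exp (-1 * x)) * (α * x ^ (-(α + 1)))) ∩ Ioi 0 := by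
      intro x hx
      have hx0 : 0 < x := hx
      refine ⟨?_, hx⟩
      have : Real.exp (-1 * x) < 1 := by
        rw [Real.exp_lt_one_iff]; linarith
      have h2 : 0 < 1 - Real.exp (-1 * x) := by linarith
      exact (by positivity : 0 < (1 - Real.exp (-1 * x)) * (α * x ^ (-(α + 1)))).ne'
    refine lt_of_lt_of_le ?_ (measure_mono this)
    simp
  · refine (ae_restrict_iff' measurableSet_Ioi).2 (.of_forall fun x hx => ?_)
    have hx0 : 0 < x := hx
    have : Real.exp (-1 * x) ≤ 1 := Real.exp_le_one_iff.2 (by linarith)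
    have h2 : 0 ≤ 1 - Real.exp (-1 * x) := by linarith
    simp only [Pi.zero_apply]; positivity
  · exact integrableOn_levy hα hα' one_pos

open ProbabilityTheory in
-- The Pareto law is the Lévy measure cut off below ε and normalised by its mass ε ^ (-α).
lemma integral_exp_pareto {α l ε : ℝ} (hα : 0 < α) (hα' : α < 1) (hl : 0 < l) (hε : 0 < ε) :
    ∫ x, Real.exp (-l * x) ∂(paretoMeasure ε α) = 1 - ε ^ α *
      ∫ x in Ioi ε, (1 - Real.exp (-l * x)) * (α * x ^ (-(α + 1))) := by
  have := isProbabilityMeasure_paretoMeasure hε hα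
  have hae : ∀ᵐ x ∂(paretoMeasure ε α), ε ≤ x := by
    rw [ae_iff, paretoMeasure, withDensity_apply _ (by measurability)]
    have : {a : ℝ | ¬ ε ≤ a} = Iio ε := by ext; simp
    rw [this]; exact lintegral_paretoPDF_of_le le_rfl
  have hint : Integrable (fun x => Real.exp (-l * x)) (paretoMeasure ε α) := by
    refine Integrable.of_bound (C := 1) (by fun_prop) ?_
    filter_upwards [hae] with x hx
    rw [Real.norm_of_nonneg (Real.exp_pos _).le]
    exact Real.exp_le_one_iff.2 (by nlinarith)
  have h1 : ∫ x, (1 - Real.exp (-l * x)) ∂(paretoMeasure ε α) = ε ^ α *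
      ∫ x in Ioi ε, (1 - Real.exp (-l * x)) * (α * x ^ (-(α + 1))) := by
    rw [paretoMeasure, integral_withDensity_eq_integral_toReal_smul
      (by unfold paretoPDF; fun_prop) (by simp [paretoPDF])]
    rw [← integral_const_mul, ← integral_Ici_eq_integral_Ioi, ← integral_indicator measurableSet_Ici]
    congr 1; ext x
    by_cases hx : ε ≤ x
    · have hx0 : 0 < x := hε.trans_le hx
      rw [indicator_of_mem (by exact hx), paretoPDF_of_le hx, ENNReal.toReal_ofReal (by positivity),
        smul_eq_mul]
      ring
    · rw [indicator_of_notMem (by exact hx), paretoPDF_of_lt (not_le.1 hx)]; simp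
  rw [← h1, integral_sub (integrable_const _) hint]
  simp

/-- A compound limit (1 - x_N / (N + 1)) ^ N → exp(-x): the cutoff is chosen so that ε ^ α = 1 / (N
+ 1), and x_N tends to the full Lévy integral. Using N + 1 keeps the cutoff positive at N = 0. -/
lemma tendsto_laplace_pareto {α l : ℝ} (hα : 0 < α) (hα' : α < 1) (hl : 0 < l) :
    Tendsto (fun N : ℕ => (∫ x, Real.exp (-l * x)
      ∂(ProbabilityTheory.paretoMeasure (((N : ℝ) + 1) ^ (-(1 / α))) α)) ^ N) atTop
      (𝓝 (Real.exp (-(levyConst α * l ^ α)))) := by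
  set F : ℝ → ℝ := fun x => (1 - Real.exp (-l * x)) * (α * x ^ (-(α + 1))) with hF
  have hlim0 : Tendsto (fun N : ℕ => ((N : ℝ) + 1) ^ (-(1 / α))) atTop (𝓝 0) :=
    (tendsto_rpow_neg_atTop (by positivity)).comp
      (tendsto_atTop_add_const_right _ _ tendsto_natCast_atTop_atTop)
  have hpos : ∀ N : ℕ, 0 < ((N : ℝ) + 1) ^ (-(1 / α)) := fun N => by positivity
  have hanti : ∀ a b : ℕ, a ≤ b → ((b : ℝ) + 1) ^ (-(1 / α)) ≤ ((a : ℝ) + 1) ^ (-(1 / α)) := by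
    intro a b hab
    refine Real.rpow_le_rpow_of_nonpos (by positivity) (by gcongr) ?_
    simp only [Left.neg_nonpos_iff]; positivity
  have hU : ⋃ N : ℕ, Ioi (((N : ℝ) + 1) ^ (-(1 / α))) = Ioi 0 := by
    ext x
    simp only [mem_iUnion, mem_Ioi]
    refine ⟨fun ⟨N, h⟩ => (hpos N).trans h, fun hx => ?_⟩
    exact ((hlim0.eventually (gt_mem_nhds hx)).exists)
  have hset : Tendsto (fun N : ℕ => ∫ x in Ioi (((N : ℝ) + 1) ^ (-(1 / α))), F x) atTop
      (𝓝 (levyConst α * l ^ α)) := by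
    rw [← integral_levy hl, ← hU]
    refine tendsto_setIntegral_of_monotone (fun _ => measurableSet_Ioi) ?_ ?_
    · intro a b hab
      exact Ioi_subset_Ioi (hanti a b hab)
    · rw [hU]; exact integrableOn_levy hα hα' hl
  have hrat : Tendsto (fun N : ℕ => (N : ℝ) / ((N : ℝ) + 1)) atTop (𝓝 1) :=
    tendsto_natCast_div_add_atTop 1
  have hpow : ∀ N : ℕ, (((N : ℝ) + 1) ^ (-(1 / α))) ^ α = ((N : ℝ) + 1)⁻¹ := by
    intro N
    rw [← Real.rpow_mul (by positivity), show -(1 / α) * α = -1 by field_simp, Real.rpow_neg_one]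
  have := Real.tendsto_one_add_pow_exp_of_tendsto
    (g := fun N : ℕ => -(((N : ℝ) + 1)⁻¹ * ∫ x in Ioi (((N : ℝ) + 1) ^ (-(1 / α))), F x))
    (t := -(levyConst α * l ^ α)) (by
      have h := (hrat.mul hset).neg
      rw [one_mul] at h
      refine h.congr fun N => ?_
      rw [div_eq_mul_inv]; ring)
  refine this.congr fun N => ?_
  rw [integral_exp_pareto hα hα' hl (hpos N), hpow]
  ring

/-- In the variable z = exp(-x), Laplace transforms become moments and sums of independent variables
become products, so the k-fold product law does the job. -/
lemma exists_measure_moment_pow (ν : Measure I) [IsProbabilityMeasure ν] (k : ℕ) :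
    ∃ P : ProbabilityMeasure I, ∀ l : ℝ, 0 < l →
      ∫ z, (z : ℝ) ^ l ∂(P : Measure I) = (∫ z, (z : ℝ) ^ l ∂ν) ^ k := by
  induction k with
  | zero =>
    refine ⟨⟨Measure.dirac 1, inferInstance⟩, fun l hl => ?_⟩
    simp
  | succ k ih =>
    obtain ⟨P, hP⟩ := ih
    refine ⟨⟨((P : Measure I).prod ν).map (fun p : I × I => p.1 * p.2),
      Measure.isProbabilityMeasure_map (by fun_prop)⟩, fun l hl => ?_⟩
    have hc : Continuous (fun z : I => (z : ℝ) ^ l) :=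
      continuous_subtype_val.rpow_const (fun _ => Or.inr hl.le)
    simp only [ProbabilityMeasure.coe_mk]
    rw [integral_map (by fun_prop) hc.aestronglyMeasurable]
    have : ∀ p : I × I, (((p.1 * p.2 : I)) : ℝ) ^ l = (p.1 : ℝ) ^ l * (p.2 : ℝ) ^ l := by
      intro p
      rw [Icc.coe_mul, Real.mul_rpow p.1.2.1 p.2.2.1]
    simp_rw [this]
    rw [integral_prod_mul (fun z : I => (z : ℝ) ^ l) (fun z : I => (z : ℝ) ^ l), hP l hl, pow_succ]

/-- On the compact interval no tightness argument is needed: probability measures form a compact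
space, and z ↦ z ^ l is a continuous test function, so moments pass to the limit. -/
lemma exists_unitInterval_stable {α : ℝ} (hα : 0 < α) (hα' : α < 1) :
    ∃ P : ProbabilityMeasure I, ∀ l : ℝ, 0 < l →
      ∫ z, (z : ℝ) ^ l ∂(P : Measure I) = Real.exp (-(levyConst α * l ^ α)) := by
  have key : ∀ N : ℕ, ∃ P : ProbabilityMeasure I, ∀ l : ℝ, 0 < l →
      ∫ z, (z : ℝ) ^ l ∂(P : Measure I) = (∫ x, Real.exp (-l * x)
        ∂(ProbabilityTheory.paretoMeasure (((N : ℝ) + 1) ^ (-(1 / α))) α)) ^ N := by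
    intro N
    set ε : ℝ := ((N : ℝ) + 1) ^ (-(1 / α)) with hε
    have hε0 : 0 < ε := by positivity
    have := ProbabilityTheory.isProbabilityMeasure_paretoMeasure hε0 hα
    have hme : Measurable (fun x : ℝ => projIcc (0 : ℝ) 1 zero_le_one (Real.exp (-x))) :=
      (continuous_projIcc.comp (by fun_prop)).measurable
    have : IsProbabilityMeasure ((ProbabilityTheory.paretoMeasure ε α).map
        (fun x : ℝ => projIcc (0 : ℝ) 1 zero_le_one (Real.exp (-x)))) :=
      Measure.isProbabilityMeasure_map hme.aemeasurable
    obtain ⟨P, hP⟩ := exists_measure_moment_pow ((ProbabilityTheory.paretoMeasure ε α).map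
        (fun x : ℝ => projIcc (0 : ℝ) 1 zero_le_one (Real.exp (-x)))) N
    refine ⟨P, fun l hl => ?_⟩
    have hc : Continuous (fun z : I => (z : ℝ) ^ l) :=
      continuous_subtype_val.rpow_const (fun _ => Or.inr hl.le)
    rw [hP l hl, integral_map hme.aemeasurable hc.aestronglyMeasurable]
    congr 1
    refine integral_congr_ae ?_
    have hae : ∀ᵐ x ∂(ProbabilityTheory.paretoMeasure ε α), ε ≤ x := by
      rw [ae_iff, ProbabilityTheory.paretoMeasure, withDensity_apply _ (by measurability)]
      have : {a : ℝ | ¬ ε ≤ a} = Iio ε := by ext; simp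
      rw [this]; exact ProbabilityTheory.lintegral_paretoPDF_of_le le_rfl
    filter_upwards [hae] with x hx
    have hx0 : 0 ≤ x := hε0.le.trans hx
    rw [projIcc_of_mem zero_le_one ⟨(Real.exp_pos _).le, Real.exp_le_one_iff.2 (by linarith)⟩]
    rw [← Real.exp_mul]; congr 1; ring
  choose P hP using key
  -- A limit along an ultrafilter replaces the extraction of a subsequence.
  obtain ⟨Q, hQ⟩ : ∃ Q, Tendsto P (hyperfilter ℕ) (𝓝 Q) := by
    obtain ⟨Q, -, hQ⟩ := isCompact_univ.ultrafilter_le_nhds ((hyperfilter ℕ).map P) (by simp)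
    exact ⟨Q, hQ⟩
  refine ⟨Q, fun l hl => ?_⟩
  have hc : Continuous (fun z : I => (z : ℝ) ^ l) :=
    continuous_subtype_val.rpow_const (fun _ => Or.inr hl.le)
  have h1 := (ProbabilityMeasure.tendsto_iff_forall_integral_tendsto.1 hQ)
    (BoundedContinuousFunction.mkOfCompact ⟨_, hc⟩)
  have h2 := (tendsto_laplace_pareto hα hα' hl).mono_left (Nat.hyperfilter_le_atTop)
  refine tendsto_nhds_unique h1 (h2.congr fun N => ?_)
  rw [← hP N l hl]
  rfl

/-- The one-sided `α`-stable law: its Laplace transform is `exp (-l ^ α)`. -/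
theorem exists_stable_subordinator {α : ℝ} (hα : 0 < α) (hα' : α < 1) :
    ∃ μ : Measure ℝ, IsProbabilityMeasure μ ∧ (∀ᵐ s ∂μ, 0 < s) ∧
      ∀ l : ℝ, 0 ≤ l → ∫ s, Real.exp (-l * s) ∂μ = Real.exp (-l ^ α) := by
  obtain ⟨P, hP⟩ := exists_unitInterval_stable hα hα'
  have ha := levyConst_pos hα hα'
  set a := levyConst α
  have hc : ∀ l : ℝ, 0 < l → Continuous (fun z : I => (z : ℝ) ^ l) := fun l hl =>
    continuous_subtype_val.rpow_const (fun _ => Or.inr hl.le)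
  have hint : ∀ l : ℝ, 0 < l → Integrable (fun z : I => (z : ℝ) ^ l) (P : Measure I) := fun l hl =>
    Integrable.of_bound (C := 1) (hc l hl).aestronglyMeasurable (.of_forall fun z => by
      rw [Real.norm_of_nonneg (Real.rpow_nonneg z.2.1 _)]
      exact Real.rpow_le_one z.2.1 z.2.2 hl.le)
  -- No mass escapes to x = ∞, that is z = 0: let l → 0 in the moments.
  have h0 : (P : Measure I).real {0} = 0 := by
    have hle : ∀ l : ℝ, 0 < l → (P : Measure I).real {0} ≤ 1 - Real.exp (-(a * l ^ α)) := by
      intro l hl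
      rw [← hP l hl]
      have h1 : ∫ z, (z : ℝ) ^ l ∂(P : Measure I) ≤
          ∫ z, (({0} : Set I)ᶜ).indicator (fun _ => (1 : ℝ)) z ∂(P : Measure I) := by
        refine integral_mono (hint l hl) ((integrable_const _).indicator (by measurability)) ?_
        intro z
        by_cases hz : z = 0
        · simp [hz, Real.zero_rpow hl.ne']
        · rw [indicator_of_mem (by simpa using hz)]
          exact Real.rpow_le_one z.2.1 z.2.2 hl.le
      rw [integral_indicator_const _ (by measurability), probReal_compl_eq_one_sub (by measurability)]
        at h1
      simp only [smul_eq_mul, mul_one] at h1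
      linarith
    have hlim : Tendsto (fun l : ℝ => 1 - Real.exp (-(a * l ^ α))) (𝓝[>] 0) (𝓝 0) := by
      have : Tendsto (fun l : ℝ => 1 - Real.exp (-(a * l ^ α))) (𝓝 0)
          (𝓝 (1 - Real.exp (-(a * 0 ^ α)))) := by
        refine Continuous.tendsto ?_ 0
        have : Continuous (fun l : ℝ => l ^ α) := Real.continuous_rpow_const hα.le
        fun_prop
      rw [Real.zero_rpow hα.ne'] at this
      simp only [mul_zero, neg_zero, Real.exp_zero, sub_self] at this
      exact this.mono_left nhdsWithin_le_nhds
    exact le_antisymm (ge_of_tendsto hlim (eventually_mem_nhdsWithin.mono hle)) measureReal_nonneg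
  -- No atom at x = 0, that is z = 1: let l → ∞.
  have h1 : (P : Measure I).real {1} = 0 := by
    have hle : ∀ l : ℝ, 0 < l → (P : Measure I).real {1} ≤ Real.exp (-(a * l ^ α)) := by
      intro l hl
      rw [← hP l hl]
      have h1 : ∫ z, (({1} : Set I)).indicator (fun _ => (1 : ℝ)) z ∂(P : Measure I) ≤
          ∫ z, (z : ℝ) ^ l ∂(P : Measure I) := by
        refine integral_mono ((integrable_const _).indicator (by measurability)) (hint l hl) ?_
        intro z
        by_cases hz : z = 1
        · simp [hz]
        · rw [indicator_of_notMem (by simpa using hz)]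
          exact Real.rpow_nonneg z.2.1 _
      rw [integral_indicator_const _ (by measurability)] at h1
      simpa using h1
    have hlim : Tendsto (fun l : ℝ => Real.exp (-(a * l ^ α))) atTop (𝓝 0) :=
      Real.tendsto_exp_neg_atTop_nhds_zero.comp
        ((tendsto_rpow_atTop hα).const_mul_atTop ha)
    exact le_antisymm (ge_of_tendsto hlim ((eventually_gt_atTop 0).mono hle)) measureReal_nonneg
  have h0' : ∀ᵐ z ∂(P : Measure I), z ≠ 0 := by
    rw [ae_iff]; simpa [measureReal_def, ENNReal.toReal_eq_zero_iff] using h0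
  have h1' : ∀ᵐ z ∂(P : Measure I), z ≠ 1 := by
    rw [ae_iff]; simpa [measureReal_def, ENNReal.toReal_eq_zero_iff] using h1
  -- The rescaling by c turns the exponent a * l ^ α into l ^ α.
  set c : ℝ := a ^ (-(1 / α))
  have hc0 : 0 < c := by positivity
  have hm : Measurable (fun z : I => c * (-Real.log (z : ℝ))) :=
    ((Real.measurable_log.comp measurable_subtype_coe).neg).const_mul c
  refine ⟨(P : Measure I).map (fun z : I => c * (-Real.log (z : ℝ))),
    Measure.isProbabilityMeasure_map hm.aemeasurable, ?_, ?_⟩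
  · refine (ae_map_iff hm.aemeasurable (measurableSet_lt measurable_const measurable_id)).2 ?_
    filter_upwards [h0', h1'] with z hz0 hz1
    have hz0 : 0 < (z : ℝ) := lt_of_le_of_ne z.2.1 (fun h => hz0 (Subtype.ext h.symm))
    have hz1 : (z : ℝ) < 1 := lt_of_le_of_ne z.2.2 (fun h => hz1 (Subtype.ext h))
    have := Real.log_neg hz0 hz1
    exact mul_pos hc0 (by linarith)
  · intro l hl
    rw [integral_map hm.aemeasurable (by fun_prop)]
    rcases hl.eq_or_lt with rfl | hl
    · simp [Real.zero_rpow hα.ne']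
    have : ∫ z : I, Real.exp (-l * (c * (-Real.log (z : ℝ)))) ∂(P : Measure I) =
        ∫ z : I, (z : ℝ) ^ (l * c) ∂(P : Measure I) := by
      refine integral_congr_ae ?_
      filter_upwards [h0'] with z hz0
      have hz0 : 0 < (z : ℝ) := lt_of_le_of_ne z.2.1 (fun h => hz0 (Subtype.ext h.symm))
      rw [Real.rpow_def_of_pos hz0]; congr 1; ring
    rw [this, hP _ (by positivity), Real.mul_rpow hl.le hc0.le]
    congr 2
    have : c ^ α = a⁻¹ := by
      rw [← Real.rpow_mul ha.le, show -(1 / α) * α = -1 by field_simp, Real.rpow_neg_one]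
    rw [this]; field_simp

/-- A positive law with Laplace transform `exp (-l ^ α)` has all negative moments. -/
theorem integrable_rpow_neg_of_laplace {α : ℝ} (hα : 0 < α) {μ : Measure ℝ} [IsProbabilityMeasure μ]
    (hpos : ∀ᵐ s ∂μ, 0 < s)
    (hμ : ∀ l : ℝ, 0 ≤ l → ∫ s, Real.exp (-l * s) ∂μ = Real.exp (-l ^ α)) {b : ℝ} (hb : 0 ≤ b) :
    Integrable (fun s : ℝ => s ^ (-b)) μ := by
  rcases hb.eq_or_lt with rfl | hb
  · simp
  -- Write Γ(b) s ^ (-b) as the integral of l ^ (b - 1) exp(-l s) over l. Integrating in s first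
  -- leaves l ^ (b - 1) exp(-l ^ α), which is integrable.
  have hI : Integrable (Function.uncurry fun (l s : ℝ) => l ^ (b - 1) * Real.exp (-l * s))
      ((volume.restrict (Ioi 0)).prod μ) := by
    have hme : Measurable (Function.uncurry fun (l s : ℝ) => l ^ (b - 1) * Real.exp (-l * s)) := by
      unfold Function.uncurry; fun_prop
    rw [integrable_prod_iff hme.aestronglyMeasurable]
    refine ⟨(ae_restrict_iff' measurableSet_Ioi).2 (.of_forall fun l hl => ?_), ?_⟩
    · have hl : 0 < l := hl
      have h1 : Integrable (fun s : ℝ => Real.exp (-l * s)) μ := by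
        refine Integrable.of_bound (C := 1) (by fun_prop) ?_
        filter_upwards [hpos] with s hs
        rw [Real.norm_of_nonneg (Real.exp_pos _).le]
        exact Real.exp_le_one_iff.2 (by nlinarith)
      exact h1.const_mul (l ^ (b - 1))
    · have := integrableOn_rpow_mul_exp_neg_rpow (s := b - 1) (p := α) (by linarith) hα
      refine this.congr_fun (fun l hl => ?_) measurableSet_Ioi
      have hl : 0 < l := hl
      simp only [Function.uncurry_apply_pair]
      rw [← hμ l hl.le, ← integral_const_mul]
      congr 1; ext s
      rw [Real.norm_of_nonneg (by positivity)]
  have h2 := hI.integral_prod_right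
  have h3 : Integrable (fun s : ℝ => (Real.Gamma b)⁻¹ *
      ∫ l in Ioi (0 : ℝ), l ^ (b - 1) * Real.exp (-l * s)) μ := h2.const_mul _
  refine h3.congr ?_
  filter_upwards [hpos] with s hs
  have h4 := Real.integral_rpow_mul_exp_neg_mul_Ioi hb hs
  have h5 : ∫ l in Ioi (0 : ℝ), l ^ (b - 1) * Real.exp (-l * s) =
      ∫ l in Ioi (0 : ℝ), l ^ (b - 1) * Real.exp (-(s * l)) := by
    congr 1; ext l; congr 2; ring
  rw [h5, h4]
  have := (Real.Gamma_pos_of_pos hb).ne'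
  rw [one_div, Real.inv_rpow hs.le, Real.rpow_neg hs.le]
  field_simp

end

variable {n : ℕ}

/-! ### Gaussians are Schwartz functions -/

/-- The power is dominated by an exponential, and completing the square gives r - c r² ≤ 1 / (4c).
-/
lemma one_add_pow_mul_exp_neg_sq_le {c : ℝ} (hc : 0 < c) (m : ℕ) {r : ℝ} (hr : 0 ≤ r) :
    (1 + r) ^ m * Real.exp (-c * r ^ 2) ≤ m.factorial * Real.exp (1 + 1 / (4 * c)) := by
  have h1 : (1 + r) ^ m ≤ m.factorial * Real.exp (1 + r) := by
    have := Real.pow_div_factorial_le_exp (1 + r) (by positivity) m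
    rwa [div_le_iff₀' (by positivity)] at this
  calc (1 + r) ^ m * Real.exp (-c * r ^ 2)
      ≤ (m.factorial * Real.exp (1 + r)) * Real.exp (-c * r ^ 2) := by gcongr
    _ = m.factorial * Real.exp (1 + r + -c * r ^ 2) := by rw [mul_assoc, ← Real.exp_add]
    _ ≤ _ := by
      gcongr ?_ * Real.exp ?_
      have h : 1 / (4 * c) - r + c * r ^ 2 = c * (r - 1 / (2 * c)) ^ 2 := by field_simp; ring
      have h2 : 0 ≤ c * (r - 1 / (2 * c)) ^ 2 := by positivity
      linarith

lemma exists_schwartz_gaussian (n : ℕ) {c : ℝ} (hc : 0 < c) :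
    ∃ G : 𝓢(Sp n, ℝ), ∀ x, G x = Real.exp (-c * ‖x‖ ^ 2) := by
  have hg : ContDiff ℝ (⊤ : ℕ∞) (fun y : ℝ => Real.exp (-c * y)) := by fun_prop
  have hf : ContDiff ℝ (⊤ : ℕ∞) (fun x : Sp n => ‖x‖ ^ 2) := contDiff_norm_sq ℝ
  refine ⟨⟨(fun y : ℝ => Real.exp (-c * y)) ∘ (fun x : Sp n => ‖x‖ ^ 2), hg.comp hf, ?_⟩,
    fun x => rfl⟩
  intro k m
  obtain ⟨p, C, hC, hb⟩ := (Function.hasTemperateGrowth_norm_sq (H := Sp n)).norm_iteratedFDeriv_le_uniform m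
  set B : ℝ := max 1 c ^ m with hB
  refine ⟨m.factorial * B * (1 + C) ^ m *
    ((k + p * m).factorial * Real.exp (1 + 1 / (4 * c))), fun x => ?_⟩
  -- Faà di Bruno: derivatives of the outer exponential carry the Gaussian factor, those of the
  -- squared norm only polynomial growth.
  have h := norm_iteratedFDeriv_comp_le hg hf (n := m) (by exact_mod_cast le_top) x
    (C := B * Real.exp (-c * ‖x‖ ^ 2)) (D := (1 + C) * (1 + ‖x‖) ^ p) ?_ ?_
  · calc _ ≤ (1 + ‖x‖) ^ k * (m.factorial * (B * Real.exp (-c * ‖x‖ ^ 2)) *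
          ((1 + C) * (1 + ‖x‖) ^ p) ^ m) := by
          gcongr; linarith
      _ = m.factorial * B * (1 + C) ^ m * ((1 + ‖x‖) ^ (k + p * m) * Real.exp (-c * ‖x‖ ^ 2)) := by
          rw [mul_pow, pow_add, pow_mul]; ring
      _ ≤ _ := by
          refine mul_le_mul_of_nonneg_left ?_ (by positivity)
          exact one_add_pow_mul_exp_neg_sq_le hc _ (norm_nonneg x)
  · intro i hi
    rw [norm_iteratedFDeriv_eq_norm_iteratedDeriv, iteratedDeriv_exp_const_mul]
    simp only [norm_mul, norm_pow, norm_neg, Real.norm_eq_abs, abs_of_pos hc, Real.abs_exp]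
    gcongr
    calc c ^ i ≤ max 1 c ^ i := by gcongr; exact le_max_right _ _
      _ ≤ max 1 c ^ m := pow_le_pow_right₀ (le_max_left _ _) hi
  · intro i hi1 hi
    have h1 : 1 ≤ (1 + C) * (1 + ‖x‖) ^ p := by
      have : 1 ≤ (1 + ‖x‖) ^ p := one_le_pow₀ (by linarith [norm_nonneg x])
      nlinarith
    calc _ ≤ C * (1 + ‖x‖) ^ p := hb i hi x
      _ ≤ (1 + C) * (1 + ‖x‖) ^ p := by gcongr; linarith
      _ ≤ _ := le_self_pow₀ h1 (by omega)

/-! ### Superpositions of dilates -/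

lemma fourierInv_comp_smul (f : Sp n → ℂ) {a : ℝ} (ha : 0 < a) (x : Sp n) :
    𝓕⁻ (fun ξ => f (a • ξ)) x = ((a ^ n)⁻¹ : ℝ) * 𝓕⁻ f (a⁻¹ • x) := by
  rw [Real.fourierInv_eq', Real.fourierInv_eq']
  have h := Measure.integral_comp_smul_of_nonneg (volume : Measure (Sp n))
    (fun v : Sp n => Complex.exp ((2 * Real.pi * inner ℝ v (a⁻¹ • x) : ℝ) * Complex.I) • f v) a
    (hR := ha.le)
  rw [finrank_euclideanSpace_fin] at h
  rw [← Complex.real_smul, ← h]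
  congr 1; ext v
  rw [inner_smul_left, inner_smul_right]
  simp only [conj_trivial]
  rw [mul_inv_cancel_left₀ ha.ne']

lemma continuous_fourierInv {f : Sp n → ℂ} (hf : Integrable f) : Continuous (𝓕⁻ f) := by
  have : Continuous (𝓕 f) := by
    have := VectorFourier.fourierIntegral_continuous Real.continuous_fourierChar
      (L := innerₗ (Sp n)) (by simpa using continuous_inner) hf
    exact this
  have h2 : 𝓕⁻ f = fun w => 𝓕 f (-w) := by ext w; exact Real.fourierInv_eq_fourier_neg f w
  rw [h2]; exact this.comp continuous_neg

lemma integrable_comp_dilate {f : Sp n → ℂ} (hf : Integrable f) {a : ℝ} (ha : 0 < a) :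
    Integrable (fun x => f (a • x)) := by
  exact (integrable_comp_smul_iff volume f ha.ne').2 hf

lemma integral_norm_comp_dilate (f : Sp n → ℂ) {a : ℝ} (ha : 0 < a) :
    ∫ x, ‖f (a • x)‖ = (a ^ n)⁻¹ * ∫ x, ‖f x‖ := by
  have := Measure.integral_comp_smul_of_nonneg (volume : Measure (Sp n)) (fun x => ‖f x‖) a (hR := ha.le)
  rwa [finrank_euclideanSpace_fin, smul_eq_mul] at this

section Superposition

variable {Ω : Type*} [MeasurableSpace Ω] {ρ : Measure Ω} {a w : Ω → ℝ}
  {q : Sp n → ℂ}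

lemma integrable_prod_dilate (hqm : Measurable q) (hq : Integrable q) (ha : Measurable a)
    (hpos : ∀ᵐ r ∂ρ, 0 < a r) (hw : Measurable w)
    (hw1 : Integrable (fun r => w r * (a r ^ n)⁻¹) ρ) :
    Integrable (Function.uncurry fun (r : Ω) (ξ : Sp n) => (w r : ℂ) * q (a r • ξ))
      (ρ.prod volume) := by
  have hm : Measurable (Function.uncurry fun (r : Ω) (ξ : Sp n) => (w r : ℂ) * q (a r • ξ)) := by
    unfold Function.uncurry; fun_prop
  rw [integrable_prod_iff hm.aestronglyMeasurable]
  refine ⟨?_, ?_⟩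
  · filter_upwards [hpos] with r hr
    exact (integrable_comp_dilate hq hr).const_mul (w r : ℂ)
  · have h : Integrable (fun r => ‖w r * (a r ^ n)⁻¹‖ * ∫ x, ‖q x‖) ρ := hw1.norm.mul_const _
    refine h.congr ?_
    filter_upwards [hpos] with r hr
    simp only [Function.uncurry_apply_pair, norm_mul, Complex.norm_real]
    rw [integral_const_mul, integral_norm_comp_dilate q hr, Real.norm_of_nonneg (r := (a r ^ n)⁻¹)
      (by positivity)]
    ring

lemma fourierInv_superposition [SFinite ρ] (hqm : Measurable q) (hq : Integrable q) (ha : Measurable a)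
    (hpos : ∀ᵐ r ∂ρ, 0 < a r) (hw : Measurable w)
    (hw1 : Integrable (fun r => w r * (a r ^ n)⁻¹) ρ) (x : Sp n) :
    𝓕⁻ (fun ξ => ∫ r, (w r : ℂ) * q (a r • ξ) ∂ρ) x =
      ∫ r, ((w r * (a r ^ n)⁻¹ : ℝ) : ℂ) * 𝓕⁻ q ((a r)⁻¹ • x) ∂ρ := by
  have hI := integrable_prod_dilate hqm hq ha hpos hw hw1
  rw [Real.fourierInv_eq']
  have h1 : ∀ v : Sp n, Complex.exp ((2 * Real.pi * inner ℝ v x : ℝ) * Complex.I) •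
      ∫ r, (w r : ℂ) * q (a r • v) ∂ρ = ∫ r, Complex.exp ((2 * Real.pi * inner ℝ v x : ℝ) * Complex.I)
        * ((w r : ℂ) * q (a r • v)) ∂ρ := by
    intro v; rw [integral_const_mul, smul_eq_mul]
  simp_rw [h1]
  rw [integral_integral_swap]
  · refine integral_congr_ae ?_
    filter_upwards [hpos] with r hr
    rw [Complex.ofReal_mul, mul_assoc, ← fourierInv_comp_smul q hr, Real.fourierInv_eq',
      ← integral_const_mul]
    congr 1; ext v; simp only [smul_eq_mul]; ring
  · refine Integrable.mono hI.swap ?_ (.of_forall fun p => ?_)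
    · refine AEStronglyMeasurable.mul ?_ hI.swap.aestronglyMeasurable
      have : Continuous fun v : Sp n =>
          Complex.exp ((2 * Real.pi * inner ℝ v x : ℝ) * Complex.I) := by fun_prop
      exact this.aestronglyMeasurable.comp_fst
    · simp only [Function.uncurry, Function.comp_apply, Prod.fst_swap, Prod.snd_swap, norm_mul]
      rw [Complex.norm_exp_ofReal_mul_I, one_mul]

lemma integrable_superposition [SFinite ρ] (hqm : Measurable q) (hq : Integrable q) (ha : Measurable a)
    (hpos : ∀ᵐ r ∂ρ, 0 < a r) (hw : Measurable w)
    (hw1 : Integrable (fun r => w r * (a r ^ n)⁻¹) ρ) :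
    Integrable (fun ξ : Sp n => ∫ r, (w r : ℂ) * q (a r • ξ) ∂ρ) :=
  (integrable_prod_dilate hqm hq ha hpos hw hw1).integral_prod_right

/-- Dilating a symbol preserves the L¹ norm of its kernel, so the kernel bound involves only the
mass of w. The stronger weight w a ^ (-n) is needed on the symbol side, to exchange the integrals.
-/
lemma integrable_fourierInv_superposition [SFinite ρ] (hqm : Measurable q) (hq : Integrable q)
    (hq' : Integrable (𝓕⁻ q)) (ha : Measurable a)
    (hpos : ∀ᵐ r ∂ρ, 0 < a r) (hw : Measurable w) (hw0 : Integrable w ρ)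
    (hw1 : Integrable (fun r => w r * (a r ^ n)⁻¹) ρ) :
    Integrable (𝓕⁻ (fun ξ : Sp n => ∫ r, (w r : ℂ) * q (a r • ξ) ∂ρ)) ∧
    ∫ x, ‖𝓕⁻ (fun ξ : Sp n => ∫ r, (w r : ℂ) * q (a r • ξ) ∂ρ) x‖ ≤
      (∫ r, ‖w r‖ ∂ρ) * ∫ x, ‖𝓕⁻ q x‖ := by
  have hcong : ∀ᵐ r ∂ρ, w r * (a r ^ n)⁻¹ * ((a r)⁻¹ ^ n)⁻¹ = w r := by
    filter_upwards [hpos] with r hr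
    rw [inv_pow, inv_inv, inv_mul_cancel_right₀ (by positivity)]
  have hI := integrable_prod_dilate (ρ := ρ) (q := 𝓕⁻ q) (a := fun r => (a r)⁻¹)
    (w := fun r => w r * (a r ^ n)⁻¹) (continuous_fourierInv hq).measurable hq' (by fun_prop)
    (by filter_upwards [hpos] with r hr; positivity) (by fun_prop)
    (hw0.congr (hcong.mono fun r hr => hr.symm))
  have he : 𝓕⁻ (fun ξ : Sp n => ∫ r, (w r : ℂ) * q (a r • ξ) ∂ρ) = fun x =>
      ∫ r, ((w r * (a r ^ n)⁻¹ : ℝ) : ℂ) * 𝓕⁻ q ((a r)⁻¹ • x) ∂ρ := by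
    ext x; exact fourierInv_superposition hqm hq ha hpos hw hw1 x
  rw [he]
  refine ⟨hI.integral_prod_right, ?_⟩
  calc ∫ x : Sp n, ‖∫ r, ((w r * (a r ^ n)⁻¹ : ℝ) : ℂ) * 𝓕⁻ q ((a r)⁻¹ • x) ∂ρ‖
      ≤ ∫ x : Sp n, ∫ r, ‖((w r * (a r ^ n)⁻¹ : ℝ) : ℂ) * 𝓕⁻ q ((a r)⁻¹ • x)‖ ∂ρ :=
        integral_mono hI.integral_prod_right.norm hI.norm.integral_prod_right
          fun x => norm_integral_le_integral_norm _
    _ = ∫ r, (∫ x : Sp n, ‖((w r * (a r ^ n)⁻¹ : ℝ) : ℂ) * 𝓕⁻ q ((a r)⁻¹ • x)‖) ∂ρ :=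
        (integral_integral_swap hI.norm).symm
    _ = ∫ r, ‖w r‖ * (∫ x, ‖𝓕⁻ q x‖) ∂ρ := by
        refine integral_congr_ae ?_
        filter_upwards [hpos, hcong] with r hr hrc
        simp only [norm_mul, Complex.norm_real]
        rw [integral_const_mul, integral_norm_comp_dilate _ (inv_pos.2 hr), ← mul_assoc]
        congr 1
        nth_rw 2 [← hrc]
        rw [norm_mul, norm_mul, Real.norm_of_nonneg (r := ((a r)⁻¹ ^ n)⁻¹) (by positivity)]
    _ = _ := integral_mul_const _ _

end Superposition

/-! ### The kernels of the semigroup and of the projected gradient -/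

/-- The Gaussian symbol `exp (-|η|²)` at the angular frequency `η = 2πξ`. -/
def gaussSymbol (ξ : Sp n) : ℂ := (Real.exp (-(4 * Real.pi ^ 2) * ‖ξ‖ ^ 2) : ℂ)

lemma measurable_gaussSymbol : Measurable (gaussSymbol : Sp n → ℂ) := by
  unfold gaussSymbol; fun_prop

lemma exists_schwartz_gaussSymbol (n : ℕ) : ∃ G : 𝓢(Sp n, ℂ), ∀ ξ, G ξ = gaussSymbol ξ := by
  obtain ⟨G, hG⟩ := exists_schwartz_gaussian n (c := 4 * Real.pi ^ 2) (by positivity)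
  exact ⟨SchwartzMap.postcompCLM (𝕜 := ℝ) Complex.ofRealCLM G, fun ξ => by
    rw [SchwartzMap.postcompCLM_apply, hG]; rfl⟩

lemma integrable_gaussSymbol : Integrable (gaussSymbol : Sp n → ℂ) := by
  obtain ⟨G, hG⟩ := exists_schwartz_gaussSymbol n
  have : (gaussSymbol : Sp n → ℂ) = G := by ext ξ; rw [hG]
  rw [this]; exact G.integrable

lemma integrable_fourierInv_of_schwartz {f : Sp n → ℂ} (G : 𝓢(Sp n, ℂ)) (hG : ∀ ξ, G ξ = f ξ) :
    Integrable (𝓕⁻ f) := by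
  have : f = G := by ext ξ; rw [hG]
  rw [this, ← SchwartzMap.fourierInv_coe]
  exact (𝓕⁻ G).integrable

lemma fourierInv_gaussSymbol (x : Sp n) :
    𝓕⁻ gaussSymbol x = (((Real.pi / (4 * Real.pi ^ 2)) ^ ((n : ℝ) / 2) *
      Real.exp (-Real.pi ^ 2 * ‖x‖ ^ 2 / (4 * Real.pi ^ 2)) : ℝ) : ℂ) := by
  have h := fourier_gaussian_innerProductSpace (V := Sp n) (b := ((4 * Real.pi ^ 2 : ℝ) : ℂ))
    (by rw [Complex.ofReal_re]; positivity) (-x)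
  rw [Real.fourierInv_eq_fourier_neg]
  have h2 : (gaussSymbol : Sp n → ℂ) = fun v =>
      Complex.exp (-((4 * Real.pi ^ 2 : ℝ) : ℂ) * ‖v‖ ^ 2) := by
    ext v; simp [gaussSymbol]
  rw [h2, h, norm_neg, finrank_euclideanSpace_fin]
  rw [Complex.ofReal_mul ((Real.pi / (4 * Real.pi ^ 2)) ^ ((n : ℝ) / 2)),
    Complex.ofReal_cpow (by positivity)]
  push_cast
  rfl

lemma gaussSymbol_smul (a : ℝ) (ξ : Sp n) :
    gaussSymbol (a • ξ) = (Real.exp (-(4 * Real.pi ^ 2) * (a ^ 2 * ‖ξ‖ ^ 2)) : ℂ) := by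
  rw [gaussSymbol, norm_smul, mul_pow, Real.norm_eq_abs, sq_abs]

/-! ### Subordination of the fractional heat symbol to Gaussians -/

section Subordination

variable {α t : ℝ} {μ : Measure ℝ}

/-- The Laplace transform of the stable law taken at t ^ (1 / α) |η|², whose α-th power is t |η| ^
(2α). -/
lemma heatSymbol_eq_integral (hα : 0 < α) (ht : 0 < t) (hpos : ∀ᵐ s ∂μ, 0 < s)
    (hμ : ∀ l : ℝ, 0 ≤ l → ∫ s, Real.exp (-l * s) ∂μ = Real.exp (-l ^ α)) (ξ : Sp n) :
    (heatSymbol α t ξ : ℂ) = ∫ s, gaussSymbol ((t ^ (1 / (2 * α)) * √s) • ξ) ∂μ := by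
  have h := hμ (t ^ (1 / α) * (2 * Real.pi * ‖ξ‖) ^ 2) (by positivity)
  have h1 : (t ^ (1 / α) * (2 * Real.pi * ‖ξ‖) ^ 2) ^ α = t * (2 * Real.pi * ‖ξ‖) ^ (2 * α) := by
    rw [Real.mul_rpow (by positivity) (by positivity), ← Real.rpow_mul ht.le,
      one_div_mul_cancel hα.ne', Real.rpow_one, Real.rpow_mul (by positivity), Real.rpow_two]
  rw [heatSymbol, neg_mul, ← h1, ← h, ← integral_complex_ofReal]
  refine integral_congr_ae ?_
  filter_upwards [hpos] with s hs
  have h2 : (t ^ (1 / (2 * α)) * √s) ^ 2 = t ^ (1 / α) * s := by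
    rw [mul_pow, Real.sq_sqrt hs.le, ← Real.rpow_natCast (t ^ (1 / (2 * α))), ← Real.rpow_mul ht.le]
    have : 1 / (2 * α) * ((2 : ℕ) : ℝ) = 1 / α := by push_cast; field_simp
    rw [this]
  rw [gaussSymbol_smul, h2]
  congr 2; ring

lemma integrable_inv_dilate_pow [IsProbabilityMeasure μ] (hα : 0 < α) (hpos : ∀ᵐ s ∂μ, 0 < s)
    (hμ : ∀ l : ℝ, 0 ≤ l → ∫ s, Real.exp (-l * s) ∂μ = Real.exp (-l ^ α)) (T : ℝ) (m : ℕ) :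
    Integrable (fun s => ((T * √s) ^ m)⁻¹) μ := by
  have h := (integrable_rpow_neg_of_laplace hα hpos hμ (b := (m : ℝ) / 2) (by positivity)).const_mul
    (T ^ m)⁻¹
  refine h.congr ?_
  filter_upwards [hpos] with s hs
  rw [mul_pow, mul_inv, Real.rpow_neg hs.le, Real.sqrt_eq_rpow, ← Real.rpow_natCast (s ^ (1 / 2 : ℝ)),
    ← Real.rpow_mul hs.le]
  congr 3; ring

end Subordination

/-- All these properties are inherited from the Gaussian kernels being averaged; the negative
moments of the stable law make the averages converge. -/
lemma heatKernel_spec (n : ℕ) {α t : ℝ} (hα : 0 < α) (hα' : α < 1) (ht : 0 < t) :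
    Integrable (fun ξ : Sp n => (heatSymbol α t ξ : ℂ)) ∧
    Integrable (heatKernel α t : Sp n → ℂ) ∧
    ∀ x : Sp n, heatKernel α t (-x) = heatKernel α t x ∧
      ∃ p : ℝ, 0 < p ∧ heatKernel α t x = p := by
  obtain ⟨μ, hprob, hpos, hμ⟩ := exists_stable_subordinator hα hα'
  have hT : 0 < t ^ (1 / (2 * α)) := by positivity
  set T := t ^ (1 / (2 * α)) with hTdef
  have hsym : (fun ξ : Sp n => (heatSymbol α t ξ : ℂ)) =
      fun ξ => ∫ s, ((1 : ℝ) : ℂ) * gaussSymbol ((T * √s) • ξ) ∂μ := by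
    ext ξ; rw [heatSymbol_eq_integral hα ht hpos hμ]; simp [hTdef]
  have ha : Measurable (fun s : ℝ => T * √s) := by fun_prop
  have hapos : ∀ᵐ s ∂μ, 0 < T * √s := by filter_upwards [hpos] with s hs; positivity
  have hw1 : Integrable (fun s => (1 : ℝ) * ((T * √s) ^ n)⁻¹) μ :=
    (integrable_inv_dilate_pow hα hpos hμ T n).const_mul 1
  have hker : ∀ x : Sp n, heatKernel α t x =
      ((∫ s, ((T * √s) ^ n)⁻¹ * ((Real.pi / (4 * Real.pi ^ 2)) ^ ((n : ℝ) / 2) *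
      Real.exp (-Real.pi ^ 2 * ‖(T * √s)⁻¹ • x‖ ^ 2 / (4 * Real.pi ^ 2))) ∂μ : ℝ) : ℂ) := by
    intro x
    rw [heatKernel, hsym, fourierInv_superposition measurable_gaussSymbol integrable_gaussSymbol
      ha hapos measurable_const hw1, ← integral_complex_ofReal]
    congr 1; ext s
    rw [fourierInv_gaussSymbol]; push_cast; ring
  refine ⟨?_, ?_, fun x => ⟨?_, _, ?_, hker x⟩⟩
  · rw [hsym]
    exact integrable_superposition measurable_gaussSymbol integrable_gaussSymbol
      ha hapos measurable_const hw1
  · rw [heatKernel, hsym]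
    obtain ⟨G, hG⟩ := exists_schwartz_gaussSymbol n
    exact (integrable_fourierInv_superposition measurable_gaussSymbol integrable_gaussSymbol
      (integrable_fourierInv_of_schwartz G hG) ha hapos measurable_const (integrable_const _) hw1).1
  · rw [hker, hker]; simp only [smul_neg, norm_neg]
  · have hI : Integrable (fun s => ((T * √s) ^ n)⁻¹ * ((Real.pi / (4 * Real.pi ^ 2)) ^ ((n : ℝ) / 2) *
      Real.exp (-Real.pi ^ 2 * ‖(T * √s)⁻¹ • x‖ ^ 2 / (4 * Real.pi ^ 2)))) μ := by
      refine (integrable_inv_dilate_pow hα hpos hμ T n).mul_bdd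
        (c := (Real.pi / (4 * Real.pi ^ 2)) ^ ((n : ℝ) / 2)) ?_ (.of_forall fun s => ?_)
      · exact Measurable.aestronglyMeasurable (by fun_prop)
      · rw [Real.norm_of_nonneg (by positivity)]
        refine mul_le_of_le_one_right (by positivity) (Real.exp_le_one_iff.2 ?_)
        rw [neg_mul, neg_div, neg_nonpos]; positivity
    rw [integral_pos_iff_support_of_nonneg_ae _ hI]
    · refine lt_of_lt_of_le (by simp : 0 < μ Set.univ) (measure_mono_ae ?_)
      filter_upwards [hapos] with s hs _
      exact (by positivity : 0 < ((T * √s) ^ n)⁻¹ * ((Real.pi / (4 * Real.pi ^ 2)) ^ ((n : ℝ) / 2) *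
        Real.exp (-Real.pi ^ 2 * ‖(T * √s)⁻¹ • x‖ ^ 2 / (4 * Real.pi ^ 2)))).ne'
    · filter_upwards [hapos] with s hs
      simp only [Pi.zero_apply]; positivity

lemma hasTemperateGrowth_coord (k : Fin n) :
    (fun ξ : Sp n => (ξ k : ℂ)).HasTemperateGrowth :=
  (Complex.ofRealCLM.comp (EuclideanSpace.proj k : Sp n →L[ℝ] ℝ)).hasTemperateGrowth

lemma fourierInv_sub_of_integrable {f g : Sp n → ℂ} (hf : Integrable f) (hg : Integrable g) :
    𝓕⁻ (fun ξ => f ξ - g ξ) = fun x => 𝓕⁻ f x - 𝓕⁻ g x := by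
  ext x
  have key : ∀ {f : Sp n → ℂ}, Integrable f → Integrable (fun v : Sp n =>
      Complex.exp ((2 * Real.pi * inner ℝ v x : ℝ) * Complex.I) • f v) := by
    intro f hf
    refine hf.bdd_mul (c := 1) (Continuous.aestronglyMeasurable (by fun_prop))
      (.of_forall fun v => ?_)
    rw [Complex.norm_exp_ofReal_mul_I]
  rw [Real.fourierInv_eq', Real.fourierInv_eq', Real.fourierInv_eq', ← integral_sub (key hf) (key hg)]
  congr 1; ext v; rw [smul_sub]

/-- `1 / |ξ|²` as a superposition of Gaussians. -/
lemma integral_Ioi_gauss {c r : ℝ} (hc : 0 < c) (hr : 0 < r) :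
    ∫ a in Set.Ioi (1 : ℝ), 2 * c * a * Real.exp (-c * (a ^ 2 * r ^ 2)) =
      Real.exp (-c * r ^ 2) / r ^ 2 := by
  have hd : ∀ x ∈ Set.Ici (1 : ℝ), HasDerivAt (fun a : ℝ => -(Real.exp (-c * (a ^ 2 * r ^ 2)) / r ^ 2))
      (2 * c * x * Real.exp (-c * (x ^ 2 * r ^ 2))) x := by
    intro x _
    have h1 : HasDerivAt (fun a : ℝ => -c * (a ^ 2 * r ^ 2)) (-c * (2 * x * r ^ 2)) x := by
      have := (((hasDerivAt_pow 2 x).mul_const (r ^ 2)).const_mul (-c))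
      simpa using this
    have h2 := (h1.exp.div_const (r ^ 2)).neg
    refine h2.congr_deriv ?_
    field_simp
  have hlim : Tendsto (fun a : ℝ => -(Real.exp (-c * (a ^ 2 * r ^ 2)) / r ^ 2)) atTop (𝓝 (-(0 / r ^ 2))) := by
    refine Tendsto.neg (Tendsto.div_const ?_ _)
    refine Real.tendsto_exp_atBot.comp ?_
    have : Tendsto (fun a : ℝ => (c * r ^ 2) * a ^ 2) atTop atTop :=
      (tendsto_pow_atTop two_ne_zero).const_mul_atTop (by positivity)
    refine (tendsto_neg_atTop_atBot.comp this).congr fun a => ?_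
    simp only [Function.comp_apply]; ring
  rw [integral_Ioi_of_hasDerivAt_of_nonneg' hd _ hlim]
  · simp
  · intro x hx
    have : 0 < x := one_pos.trans hx
    positivity

/-- The symbol of `Π_{ij} ∂_k e^{Δ}`. -/
def projGaussSymbol (i j k : Fin n) (ξ : Sp n) : ℂ :=
  (2 * Real.pi * Complex.I * (ξ k : ℂ)) * (leraySymbol i j ξ : ℂ) * gaussSymbol ξ

lemma measurable_projGaussSymbol (i j k : Fin n) : Measurable (projGaussSymbol i j k) := by
  unfold projGaussSymbol leraySymbol
  have := measurable_gaussSymbol (n := n)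
  fun_prop

/-- The symbol need not be smooth at the origin, so it is split. The δ_ij part is Schwartz. The part
with 1 / |ξ|² is a superposition over a > 1 of dilates of a cubic polynomial times a Gaussian. The
three coordinate factors turn the weight 2ca into 2c a ^ (-2), which is integrable; without the
derivative it would be of order a ^ (-1). -/
lemma projGaussSymbol_integrable (i j k : Fin n) :
    Integrable (projGaussSymbol i j k) ∧ Integrable (𝓕⁻ (projGaussSymbol i j k)) := by
  obtain ⟨G, hG⟩ := exists_schwartz_gaussSymbol n
  have hi := hasTemperateGrowth_coord i
  have hj := hasTemperateGrowth_coord j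
  have hk := hasTemperateGrowth_coord k
  set d : ℂ := 2 * Real.pi * Complex.I with hd
  have hg1 : (fun ξ : Sp n => d * (ξ k : ℂ) * (if i = j then 1 else 0)).HasTemperateGrowth := by
    exact ((Function.HasTemperateGrowth.const d).mul hk).mul (Function.HasTemperateGrowth.const _)
  have hg2 : (fun ξ : Sp n => d * (ξ k : ℂ) * ((ξ i : ℂ) * (ξ j : ℂ))).HasTemperateGrowth := by
    exact ((Function.HasTemperateGrowth.const d).mul hk).mul (hi.mul hj)
  set S1 := SchwartzMap.smulLeftCLM ℂ (fun ξ : Sp n => d * (ξ k : ℂ) * (if i = j then 1 else 0)) G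
  set S2 := SchwartzMap.smulLeftCLM ℂ (fun ξ : Sp n => d * (ξ k : ℂ) * ((ξ i : ℂ) * (ξ j : ℂ))) G
  have hS1 : ∀ ξ, S1 ξ = d * (ξ k : ℂ) * (if i = j then 1 else 0) * gaussSymbol ξ := fun ξ => by
    rw [SchwartzMap.smulLeftCLM_apply_apply hg1, hG, smul_eq_mul]
  have hS2 : ∀ ξ, S2 ξ = d * (ξ k : ℂ) * ((ξ i : ℂ) * (ξ j : ℂ)) * gaussSymbol ξ := fun ξ => by
    rw [SchwartzMap.smulLeftCLM_apply_apply hg2, hG, smul_eq_mul]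
  set c : ℝ := 4 * Real.pi ^ 2 with hc
  have hc0 : 0 < c := by positivity
  have hm : ∀ ξ : Sp n, ∫ a in Set.Ioi (1 : ℝ), ((2 * c * a ^ (-2 : ℝ) : ℝ) : ℂ) * S2 (a • ξ) =
      d * (ξ k : ℂ) * ((ξ i : ℂ) * (ξ j : ℂ) / (‖ξ‖ : ℂ) ^ 2) * gaussSymbol ξ := by
    intro ξ
    rcases eq_or_ne ξ 0 with rfl | hξ
    · simp [hS2]
    have hr : 0 < ‖ξ‖ := norm_pos_iff.2 hξ
    have h := integral_Ioi_gauss hc0 hr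
    have : ∀ a ∈ Set.Ioi (1 : ℝ), ((2 * c * a ^ (-2 : ℝ) : ℝ) : ℂ) * S2 (a • ξ) =
        (d * (ξ k : ℂ) * ((ξ i : ℂ) * (ξ j : ℂ))) *
          ((2 * c * a * Real.exp (-c * (a ^ 2 * ‖ξ‖ ^ 2)) : ℝ) : ℂ) := by
      intro a ha
      have ha0 : (0 : ℝ) < a := one_pos.trans ha
      have ha1 : (a : ℂ) ≠ 0 := by exact_mod_cast ha0.ne'
      rw [hS2, gaussSymbol_smul, ← hc, Real.rpow_neg ha0.le, Real.rpow_two]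
      simp only [PiLp.smul_apply, smul_eq_mul]
      push_cast
      field_simp
    rw [setIntegral_congr_fun measurableSet_Ioi this, integral_const_mul, integral_complex_ofReal, h,
      gaussSymbol, ← hc]
    push_cast
    ring
  have hp : projGaussSymbol i j k = fun ξ => S1 ξ -
      ∫ a in Set.Ioi (1 : ℝ), ((2 * c * a ^ (-2 : ℝ) : ℝ) : ℂ) * S2 (a • ξ) := by
    ext ξ
    have hij : (((if i = j then 1 else 0 : ℝ)) : ℂ) = if i = j then 1 else 0 := by
      split_ifs <;> simp
    rw [hm, hS1, projGaussSymbol, leraySymbol, Complex.ofReal_sub, hij, ← hd]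
    push_cast
    ring
  have hw0 : Integrable (fun a : ℝ => 2 * c * a ^ (-2 : ℝ)) (volume.restrict (Set.Ioi 1)) :=
    (integrableOn_Ioi_rpow_of_lt (by norm_num) one_pos).const_mul _
  have hwm : Measurable (fun a : ℝ => 2 * c * a ^ (-2 : ℝ)) := by fun_prop
  have hw1 : Integrable (fun a : ℝ => 2 * c * a ^ (-2 : ℝ) * (a ^ n)⁻¹)
      (volume.restrict (Set.Ioi 1)) := by
    refine hw0.mul_bdd (c := 1) (Measurable.aestronglyMeasurable (by fun_prop)) ?_
    refine (ae_restrict_iff' measurableSet_Ioi).2 (.of_forall fun a ha => ?_)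
    have ha0 : (0 : ℝ) < a := one_pos.trans ha
    rw [Real.norm_of_nonneg (by positivity)]
    exact inv_le_one_of_one_le₀ (one_le_pow₀ (le_of_lt ha))
  have hapos : ∀ᵐ a ∂(volume.restrict (Set.Ioi (1 : ℝ))), 0 < a :=
    (ae_restrict_iff' measurableSet_Ioi).2 (.of_forall fun a ha => one_pos.trans ha)
  have hJ := integrable_superposition (a := fun a : ℝ => a) S2.continuous.measurable S2.integrable
    measurable_id hapos hwm hw1
  have hJ' := (integrable_fourierInv_superposition (a := fun a : ℝ => a) S2.continuous.measurable
    S2.integrable (integrable_fourierInv_of_schwartz S2 fun _ => rfl)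
    measurable_id hapos hwm hw0 hw1).1
  rw [hp]
  refine ⟨S1.integrable.sub hJ, ?_⟩
  rw [fourierInv_sub_of_integrable S1.integrable hJ]
  exact (integrable_fourierInv_of_schwartz S1 fun _ => rfl).sub hJ'

/-- The symbol of `Π_{ij} ∂_k S(τ)`. -/
def projSymbol (α : ℝ) (i j k : Fin n) (τ : ℝ) (ξ : Sp n) : ℂ :=
  (2 * Real.pi * Complex.I * (ξ k : ℂ)) * (leraySymbol i j ξ : ℂ) * (heatSymbol α τ ξ : ℂ)

lemma leraySymbol_smul (i j : Fin n) {a : ℝ} (ha : a ≠ 0) (ξ : Sp n) :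
    leraySymbol i j (a • ξ) = leraySymbol i j ξ := by
  simp only [leraySymbol, PiLp.smul_apply, smul_eq_mul, norm_smul, mul_pow, Real.norm_eq_abs, sq_abs]
  congr 1
  rw [show a * ξ i * (a * ξ j) = a ^ 2 * (ξ i * ξ j) by ring, mul_div_mul_left _ _ (pow_ne_zero 2 ha)]

/-- The Gaussian symbol is averaged over dilations T√s with T = t ^ (1 / (2α)). Homogeneity of
degree one of the factor before the exponential gives the weight (T√s)⁻¹, whose T⁻¹ is the claimed
power of time. -/
lemma projKernel_spec (n : ℕ) {α : ℝ} (hα : 0 < α) (hα' : α < 1) :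
    ∃ C : ℝ, 0 ≤ C ∧ ∀ (i j k : Fin n) (τ : ℝ), 0 < τ →
      Integrable (projSymbol α i j k τ) ∧ Integrable (projKernel α i j k τ) ∧
      ∫ x, ‖projKernel α i j k τ x‖ ≤ C * τ ^ (-(1 / (2 * α))) := by
  obtain ⟨μ, hprob, hpos, hμ⟩ := exists_stable_subordinator hα hα'
  -- Summing over all indices makes the constant uniform in i, j, k.
  refine ⟨(∫ s, ‖(√s)⁻¹‖ ∂μ) * ∑ i : Fin n, ∑ j : Fin n, ∑ k : Fin n,
    ∫ x, ‖𝓕⁻ (projGaussSymbol i j k) x‖, by positivity, fun i j k t ht => ?_⟩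
  have hT : 0 < t ^ (1 / (2 * α)) := by positivity
  set T := t ^ (1 / (2 * α)) with hTdef
  have hapos : ∀ᵐ s ∂μ, 0 < T * √s := by filter_upwards [hpos] with s hs; positivity
  have hsym : projSymbol α i j k t =
      fun ξ => ∫ s, (((T * √s)⁻¹ : ℝ) : ℂ) * projGaussSymbol i j k ((T * √s) • ξ) ∂μ := by
    ext ξ
    rw [projSymbol, heatSymbol_eq_integral hα ht hpos hμ, ← integral_const_mul, ← hTdef]
    refine integral_congr_ae ?_
    filter_upwards [hapos] with s hs
    have hs' : ((T * √s : ℝ) : ℂ) ≠ 0 := by exact_mod_cast hs.ne'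
    rw [projGaussSymbol, leraySymbol_smul i j hs.ne']
    simp only [PiLp.smul_apply, smul_eq_mul]
    rw [Complex.ofReal_inv, Complex.ofReal_mul (T * √s)]
    set b : ℂ := ((T * √s : ℝ) : ℂ)
    set g := gaussSymbol ((T * √s) • ξ)
    field_simp
  have ha : Measurable (fun s : ℝ => T * √s) := by fun_prop
  have hw : Measurable (fun s : ℝ => (T * √s)⁻¹) := by fun_prop
  have hw0 : Integrable (fun s => (T * √s)⁻¹) μ := by
    simpa using integrable_inv_dilate_pow hα hpos hμ T 1
  have hw1 : Integrable (fun s => (T * √s)⁻¹ * ((T * √s) ^ n)⁻¹) μ := by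
    refine (integrable_inv_dilate_pow hα hpos hμ T (n + 1)).congr (.of_forall fun s => ?_)
    simp only
    rw [pow_succ', mul_inv]
  obtain ⟨hp1, hp2⟩ := projGaussSymbol_integrable i j k
  have hm := measurable_projGaussSymbol i j k
  have hker : projKernel α i j k t = 𝓕⁻ (projSymbol α i j k t) := rfl
  rw [hker, hsym]
  obtain ⟨h1, h2⟩ := integrable_fourierInv_superposition hm hp1 hp2 ha hapos hw hw0 hw1
  refine ⟨integrable_superposition hm hp1 ha hapos hw hw1, h1, h2.trans ?_⟩
  have h3 : ∫ s, ‖(T * √s)⁻¹‖ ∂μ = T⁻¹ * ∫ s, ‖(√s)⁻¹‖ ∂μ := by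
    rw [← integral_const_mul]
    congr 1; ext s
    rw [mul_inv, norm_mul, Real.norm_of_nonneg (r := T⁻¹) (by positivity)]
  have h4 : ∫ x, ‖𝓕⁻ (projGaussSymbol i j k) x‖ ≤ ∑ i : Fin n, ∑ j : Fin n, ∑ k : Fin n,
      ∫ x, ‖𝓕⁻ (projGaussSymbol i j k) x‖ := by
    calc _ ≤ ∑ k : Fin n, ∫ x, ‖𝓕⁻ (projGaussSymbol i j k) x‖ :=
          Finset.single_le_sum (f := fun k => ∫ x, ‖𝓕⁻ (projGaussSymbol i j k) x‖)
            (fun _ _ => by positivity) (Finset.mem_univ k)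
      _ ≤ ∑ j : Fin n, ∑ k : Fin n, ∫ x, ‖𝓕⁻ (projGaussSymbol i j k) x‖ :=
          Finset.single_le_sum (f := fun j => ∑ k : Fin n, ∫ x, ‖𝓕⁻ (projGaussSymbol i j k) x‖)
            (fun _ _ => by positivity) (Finset.mem_univ j)
      _ ≤ _ := Finset.single_le_sum
            (f := fun i => ∑ j : Fin n, ∑ k : Fin n, ∫ x, ‖𝓕⁻ (projGaussSymbol i j k) x‖)
            (fun _ _ => by positivity) (Finset.mem_univ i)
  rw [h3, Real.rpow_neg ht.le, ← hTdef]
  calc _ ≤ (T⁻¹ * ∫ s, ‖(√s)⁻¹‖ ∂μ) * ∑ i : Fin n, ∑ j : Fin n, ∑ k : Fin n,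
      ∫ x, ‖𝓕⁻ (projGaussSymbol i j k) x‖ := by gcongr
    _ = _ := by ring

/-! ### Convolution of an integrable kernel with a bounded function -/

/-- The convolution of `k` and `f`. -/
def cv (k f : Sp n → ℂ) (x : Sp n) : ℂ := ∫ y, k (x - y) * f y

lemma cv_eq_swap (k f : Sp n → ℂ) (x : Sp n) : cv k f x = ∫ z, k z * f (x - z) := by
  rw [cv, ← integral_sub_left_eq_self _ volume x]
  simp

lemma integrable_cv {k f : Sp n → ℂ} {B : ℝ} (hk : Integrable k) (hf : AEStronglyMeasurable f)
    (hB : ∀ᵐ x, ‖f x‖ ≤ B) (x : Sp n) : Integrable (fun y => k (x - y) * f y) :=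
  (hk.comp_sub_left x).mul_bdd hf hB

lemma norm_cv_le {k f : Sp n → ℂ} {B : ℝ} (hk : Integrable k)
    (hB : ∀ᵐ x, ‖f x‖ ≤ B) (x : Sp n) : ‖cv k f x‖ ≤ (∫ y, ‖k y‖) * B := by
  have h1 : Integrable (fun y => ‖k (x - y)‖ * B) := (hk.comp_sub_left x).norm.mul_const B
  calc ‖cv k f x‖ ≤ ∫ y, ‖k (x - y)‖ * B := by
        refine norm_integral_le_of_norm_le h1 ?_
        filter_upwards [hB] with y hy
        rw [norm_mul]; gcongr
    _ = _ := by
        rw [integral_mul_const, integral_sub_left_eq_self (fun y => ‖k y‖) volume x]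

lemma aestronglyMeasurable_cv {k f : Sp n → ℂ} (hk : Continuous k) (hf : AEStronglyMeasurable f) :
    AEStronglyMeasurable (cv k f) := by
  have h : AEStronglyMeasurable (fun p : Sp n × Sp n => k (p.1 - p.2) * f p.2)
      (volume.prod volume) :=
    (Continuous.aestronglyMeasurable (by fun_prop)).mul hf.comp_snd
  exact h.integral_prod_right'

lemma cv_add {k f g : Sp n → ℂ} {B C : ℝ} (hk : Integrable k) (hf : AEStronglyMeasurable f)
    (hg : AEStronglyMeasurable g) (hB : ∀ᵐ x, ‖f x‖ ≤ B) (hC : ∀ᵐ x, ‖g x‖ ≤ C) (x : Sp n) :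
    cv k (fun y => f y + g y) x = cv k f x + cv k g x := by
  rw [cv, cv, cv, ← integral_add (integrable_cv hk hf hB x) (integrable_cv hk hg hC x)]
  congr 1; ext y; ring

lemma integrable_double_kernel {k l : Sp n → ℂ} (hk : Integrable k) (hkc : Continuous k)
    (hl : Integrable l) (hlc : Continuous l) (x : Sp n) :
    Integrable (fun p : Sp n × Sp n => k (x - p.1) * l (p.1 - p.2)) (volume.prod volume) := by
  rw [integrable_prod_iff (Continuous.aestronglyMeasurable (by fun_prop))]
  refine ⟨.of_forall fun y => (hl.comp_sub_left y).const_mul (k (x - y)), ?_⟩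
  have : Integrable (fun y => ‖k (x - y)‖ * ∫ z, ‖l z‖) := (hk.comp_sub_left x).norm.mul_const _
  refine this.congr (.of_forall fun y => ?_)
  simp only [norm_mul]
  rw [integral_const_mul, integral_sub_left_eq_self (fun y => ‖l y‖) volume y]

lemma cv_cv {k l f : Sp n → ℂ} {B : ℝ} (hk : Integrable k) (hkc : Continuous k)
    (hl : Integrable l) (hlc : Continuous l) (hf : AEStronglyMeasurable f)
    (hB : ∀ᵐ x, ‖f x‖ ≤ B) (x : Sp n) : cv k (cv l f) x = cv (cv k l) f x := by
  have hI : Integrable (Function.uncurry fun y z : Sp n => k (x - y) * (l (y - z) * f z))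
      (volume.prod volume) := by
    have h := (integrable_double_kernel hk hkc hl hlc x).mul_bdd (c := B)
      (hf.comp_snd (μ := volume)) (by
        have := (Measure.quasiMeasurePreserving_snd (μ := (volume : Measure (Sp n)))
          (ν := (volume : Measure (Sp n)))).ae hB
        exact this)
    refine h.congr (.of_forall fun p => ?_)
    simp only [Function.uncurry]; ring
  calc cv k (cv l f) x = ∫ y, ∫ z, k (x - y) * (l (y - z) * f z) := by
        simp only [cv]; congr 1; ext y; rw [integral_const_mul]
    _ = ∫ z, ∫ y, k (x - y) * (l (y - z) * f z) := integral_integral_swap hI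
    _ = _ := by
        rw [cv]; congr 1; ext z
        rw [cv, ← integral_sub_right_eq_self (fun y => k (x - z - y) * l y) z, ← integral_mul_const]
        congr 1; ext y
        rw [show x - z - (y - z) = x - y by abel]; ring

/-- Convolution becomes multiplication of symbols. -/
lemma cv_fourierInv {k m : Sp n → ℂ} (hk : Integrable k) (hm : Integrable m) (x : Sp n) :
    cv k (𝓕⁻ m) x = 𝓕⁻ (fun ξ => 𝓕 k ξ * m ξ) x := by
  rw [cv_eq_swap, Real.fourierInv_eq']
  have hI : Integrable (Function.uncurry fun z ξ : Sp n =>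
      k z * (Complex.exp ((2 * Real.pi * inner ℝ ξ (x - z) : ℝ) * Complex.I) * m ξ))
      (volume.prod volume) := by
    have h := (hk.mul_prod hm).bdd_mul (c := 1) (f := fun p : Sp n × Sp n =>
      Complex.exp ((2 * Real.pi * inner ℝ p.2 (x - p.1) : ℝ) * Complex.I))
      (Continuous.aestronglyMeasurable (by fun_prop)) (.of_forall fun v => by
        rw [Complex.norm_exp_ofReal_mul_I])
    refine h.congr (.of_forall fun p => ?_)
    simp only [Function.uncurry]; ring
  calc ∫ z, k z * 𝓕⁻ m (x - z)
      = ∫ z, ∫ ξ, k z * (Complex.exp ((2 * Real.pi * inner ℝ ξ (x - z) : ℝ) * Complex.I) * m ξ) := by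
        congr 1; ext z
        rw [Real.fourierInv_eq', integral_const_mul]; rfl
    _ = ∫ ξ, ∫ z, k z * (Complex.exp ((2 * Real.pi * inner ℝ ξ (x - z) : ℝ) * Complex.I) * m ξ) :=
        integral_integral_swap hI
    _ = _ := by
        congr 1; ext ξ
        rw [Real.fourier_eq', smul_eq_mul, ← integral_mul_const, ← integral_const_mul]
        congr 1; ext z
        rw [smul_eq_mul, inner_sub_right, real_inner_comm z ξ]
        have : Complex.exp ((2 * Real.pi * (inner ℝ ξ x - inner ℝ z ξ) : ℝ) * Complex.I) =
            Complex.exp ((2 * Real.pi * inner ℝ ξ x : ℝ) * Complex.I) *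
            Complex.exp ((-2 * Real.pi * inner ℝ z ξ : ℝ) * Complex.I) := by
          rw [← Complex.exp_add]; congr 1; push_cast; ring
        rw [this]; ring

/-! ### The semigroup property -/

section Kernels

variable {α : ℝ}

lemma integrable_heatSymbol (hα : 0 < α) (hα' : α < 1) {t : ℝ} (ht : 0 < t) :
    Integrable (fun ξ : Sp n => (heatSymbol α t ξ : ℂ)) := (heatKernel_spec n hα hα' ht).1

lemma integrable_heatKernel (hα : 0 < α) (hα' : α < 1) {t : ℝ} (ht : 0 < t) :
    Integrable (heatKernel α t : Sp n → ℂ) := (heatKernel_spec n hα hα' ht).2.1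

lemma continuous_heatKernel (hα : 0 < α) (hα' : α < 1) {t : ℝ} (ht : 0 < t) :
    Continuous (heatKernel α t : Sp n → ℂ) := continuous_fourierInv (integrable_heatSymbol hα hα' ht)

lemma heatKernel_neg (hα : 0 < α) (hα' : α < 1) {t : ℝ} (ht : 0 < t) (x : Sp n) :
    heatKernel α t (-x) = heatKernel α t x := ((heatKernel_spec n hα hα' ht).2.2 x).1

lemma heatKernel_pos (hα : 0 < α) (hα' : α < 1) {t : ℝ} (ht : 0 < t) (x : Sp n) :
    ∃ p : ℝ, 0 < p ∧ heatKernel α t x = p := ((heatKernel_spec n hα hα' ht).2.2 x).2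

lemma continuous_heatSymbol (hα : 0 < α) (t : ℝ) :
    Continuous (fun ξ : Sp n => (heatSymbol α t ξ : ℂ)) := by
  unfold heatSymbol
  have : Continuous (fun x : ℝ => x ^ (2 * α)) := Real.continuous_rpow_const (by positivity)
  fun_prop

lemma heatSymbol_add (α s t : ℝ) (ξ : Sp n) :
    heatSymbol α (s + t) ξ = heatSymbol α s ξ * heatSymbol α t ξ := by
  rw [heatSymbol, heatSymbol, heatSymbol, ← Real.exp_add]; congr 1; ring

lemma fourier_heatKernel (hα : 0 < α) (hα' : α < 1) {t : ℝ} (ht : 0 < t) :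
    𝓕 (heatKernel α t : Sp n → ℂ) = fun ξ => (heatSymbol α t ξ : ℂ) := by
  refine (continuous_heatSymbol hα t).fourier_fourierInv_eq (integrable_heatSymbol hα hα' ht) ?_
  have h := integrable_heatKernel (n := n) hα hα' ht
  have h2 : 𝓕 (fun ξ : Sp n => (heatSymbol α t ξ : ℂ)) = fun x => heatKernel α t (-x) := by
    ext x; rw [heatKernel, Real.fourierInv_eq_fourier_neg, neg_neg]
  rw [h2]; exact h.comp_neg

lemma integral_heatKernel (hα : 0 < α) (hα' : α < 1) {t : ℝ} (ht : 0 < t) :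
    ∫ x : Sp n, heatKernel α t x = 1 := by
  have h := congrFun (fourier_heatKernel (n := n) hα hα' ht) 0
  rw [Real.fourier_eq'] at h
  simpa [heatSymbol, Real.zero_rpow (by positivity : 2 * α ≠ 0)] using h

lemma cv_heatKernel_heatKernel (hα : 0 < α) (hα' : α < 1) {s t : ℝ} (hs : 0 < s) (ht : 0 < t) :
    cv (heatKernel α s : Sp n → ℂ) (heatKernel α t) = heatKernel α (s + t) := by
  ext x
  conv_lhs => rw [heatKernel.eq_1 α t]
  rw [cv_fourierInv (integrable_heatKernel hα hα' hs) (integrable_heatSymbol hα hα' ht),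
    fourier_heatKernel hα hα' hs, heatKernel]
  refine congrArg (fun f : Sp n → ℂ => 𝓕⁻ f x) (funext fun ξ => ?_)
  rw [heatSymbol_add]; push_cast; rfl

/-- The constant in the `L¹` bound for the kernel of `Π ∂ S(τ)`. -/
def projConst (n : ℕ) (α : ℝ) : ℝ :=
  if h : 0 < α ∧ α < 1 then (projKernel_spec n h.1 h.2).choose else 0

lemma projConst_spec (hα : 0 < α) (hα' : α < 1) : 0 ≤ projConst n α ∧
    ∀ (i j k : Fin n) (τ : ℝ), 0 < τ →
      Integrable (projSymbol α i j k τ) ∧ Integrable (projKernel α i j k τ) ∧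
      ∫ x, ‖projKernel α i j k τ x‖ ≤ projConst n α * τ ^ (-(1 / (2 * α))) := by
  rw [projConst, dif_pos ⟨hα, hα'⟩]
  exact (projKernel_spec n hα hα').choose_spec

lemma continuous_projKernel (hα : 0 < α) (hα' : α < 1) (i j k : Fin n) {τ : ℝ} (hτ : 0 < τ) :
    Continuous (projKernel α i j k τ) :=
  continuous_fourierInv ((projConst_spec hα hα').2 i j k τ hτ).1

lemma cv_heatKernel_projKernel (hα : 0 < α) (hα' : α < 1) (i j k : Fin n) {s t : ℝ} (hs : 0 < s)
    (ht : 0 < t) :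
    cv (heatKernel α s) (projKernel α i j k t) = projKernel α i j k (s + t) := by
  ext x
  have h : ∀ τ, projKernel α i j k τ = 𝓕⁻ (projSymbol α i j k τ) := fun τ => rfl
  rw [h, cv_fourierInv (integrable_heatKernel hα hα' hs) ((projConst_spec hα hα').2 i j k t ht).1,
    fourier_heatKernel hα hα' hs, h]
  refine congrArg (fun f : Sp n → ℂ => 𝓕⁻ f x) (funext fun ξ => ?_)
  rw [projSymbol, projSymbol, heatSymbol_add]; push_cast; ring

/-- Joint measurability in time and space, for the Fubini arguments in the Duhamel integral; it
holds for every real time because a parametric integral of a jointly measurable integrand is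
measurable. -/
lemma measurable_projKernel (α : ℝ) (i j k : Fin n) :
    Measurable (Function.uncurry (projKernel α i j k)) := by
  have h : StronglyMeasurable (fun p : (ℝ × Sp n) × Sp n =>
      Complex.exp ((2 * Real.pi * inner ℝ p.2 p.1.2 : ℝ) * Complex.I) •
        projSymbol α i j k p.1.1 p.2) := by
    refine Measurable.stronglyMeasurable ?_
    unfold projSymbol leraySymbol heatSymbol
    fun_prop
  have h2 := h.integral_prod_right' (ν := volume)
  have h3 : Function.uncurry (projKernel α i j k) = fun p : ℝ × Sp n => ∫ v : Sp n,
      Complex.exp ((2 * Real.pi * inner ℝ v p.2 : ℝ) * Complex.I) • projSymbol α i j k p.1 v := by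
    ext p; simp only [Function.uncurry]
    rw [projKernel, Real.fourierInv_eq']; rfl
  rw [h3]
  exact h2.measurable

end Kernels

/-! ### Heat flows of tempered distributions -/

lemma ae_eq_of_forall_schwartz {f g : Sp n → ℂ} (hf : LocallyIntegrable f)
    (hg : LocallyIntegrable g) (h : ∀ φ : 𝓢(Sp n, ℂ), ∫ x, φ x * f x = ∫ x, φ x * g x) :
    f =ᵐ[volume] g := by
  refine ae_eq_of_integral_contDiff_smul_eq hf hg fun φ hφ hc => ?_
  have hg₁ : HasCompactSupport (Complex.ofRealCLM ∘ φ) := hc.comp_left rfl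
  have hg₂ : ContDiff ℝ (⊤ : ℕ∞) (Complex.ofRealCLM ∘ φ) := Complex.ofRealCLM.contDiff.comp hφ
  have := h (hg₁.toSchwartzMap hg₂)
  simpa [Complex.real_smul] using this

lemma locallyIntegrable_of_bound {f : Sp n → ℂ} {B : ℝ} (hf : AEStronglyMeasurable f)
    (hB : ∀ᵐ x, ‖f x‖ ≤ B) : LocallyIntegrable f := by
  have : MemLp f ⊤ volume := memLp_top_of_bound hf B hB
  exact this.locallyIntegrable le_top

lemma integrable_schwartz_mul (φ : 𝓢(Sp n, ℂ)) {f : Sp n → ℂ} {B : ℝ}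
    (hf : AEStronglyMeasurable f) (hB : ∀ᵐ x, ‖f x‖ ≤ B) : Integrable (fun x => φ x * f x) :=
  φ.integrable.mul_bdd hf hB

/-- Testing a convolution against a Schwartz function. -/
lemma integrable_test_cv (φ : 𝓢(Sp n, ℂ)) {k f : Sp n → ℂ} {B : ℝ} (hk : Integrable k)
    (hf : AEStronglyMeasurable f) (hB : ∀ᵐ x, ‖f x‖ ≤ B) :
    Integrable (fun p : Sp n × Sp n => (φ (p.1 + p.2) * k p.1) * f p.2) (volume.prod volume) := by
  have h1 : Integrable (fun p : Sp n × Sp n => φ (p.1 + p.2) * k p.1) (volume.prod volume) := by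
    have hm : AEStronglyMeasurable (fun p : Sp n × Sp n => φ (p.1 + p.2) * k p.1)
        (volume.prod volume) :=
      (φ.continuous.comp (continuous_fst.add continuous_snd)).aestronglyMeasurable.mul
        hk.aestronglyMeasurable.comp_fst
    rw [integrable_prod_iff hm]
    refine ⟨.of_forall fun z => (φ.integrable.comp_add_left z).mul_const (k z), ?_⟩
    have : Integrable (fun z => (∫ y, ‖φ y‖) * ‖k z‖) := hk.norm.const_mul _
    refine this.congr (.of_forall fun z => ?_)
    simp only [norm_mul]
    rw [integral_mul_const, integral_add_left_eq_self (fun y => ‖φ y‖) z]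
  exact h1.mul_bdd (c := B) (hf.comp_snd (μ := volume))
    ((Measure.quasiMeasurePreserving_snd (μ := (volume : Measure (Sp n)))
          (ν := (volume : Measure (Sp n)))).ae hB)

/-- Moves the translation onto the test function, the form in which `IsHeatFlow` and Fourier
multipliers are expressed. -/
lemma integral_test_cv (φ : 𝓢(Sp n, ℂ)) {k f : Sp n → ℂ} {B : ℝ} (hk : Integrable k)
    (hf : AEStronglyMeasurable f) (hB : ∀ᵐ x, ‖f x‖ ≤ B) :
    ∫ x, φ x * cv k f x = ∫ z, k z * ∫ y, compSubConstCLM ℂ (-z) φ y * f y := by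
  have hI := integrable_test_cv φ hk hf hB
  have hI2 : Integrable (Function.uncurry fun z x : Sp n => φ x * (k z * f (x - z)))
      (volume.prod volume) := by
    have hmp := measurePreserving_prod_sub (volume : Measure (Sp n)) (volume : Measure (Sp n))
    refine ((hmp.integrable_comp hI.aestronglyMeasurable).2 hI).congr (.of_forall fun p => ?_)
    simp only [Function.comp_apply, Function.uncurry]
    rw [add_sub_cancel]; ring
  calc ∫ x, φ x * cv k f x = ∫ x, ∫ z, φ x * (k z * f (x - z)) := by
        congr 1; ext x; rw [cv_eq_swap, integral_const_mul]
    _ = ∫ z, ∫ x, φ x * (k z * f (x - z)) := (integral_integral_swap hI2).symm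
    _ = _ := by
        congr 1; ext z
        rw [← integral_add_right_eq_self _ z, ← integral_const_mul]
        congr 1; ext y
        rw [compSubConstCLM_apply, sub_neg_eq_add, add_sub_cancel_right]; ring

/-- By positivity the convolution of the absolute values is again a heat kernel, with no loss. -/
lemma integral_norm_heatKernel_mul {α : ℝ} (hα : 0 < α) (hα' : α < 1) {s t : ℝ} (hs : 0 < s)
    (ht : 0 < t) (y : Sp n) :
    ∫ z, ‖heatKernel α s (y - z) * heatKernel α t z‖ = ‖heatKernel α (s + t) y‖ := by
  have h : ∀ z : Sp n, heatKernel α s (y - z) * heatKernel α t z =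
      ((‖heatKernel α s (y - z) * heatKernel α t z‖ : ℝ) : ℂ) := by
    intro z
    obtain ⟨p, hp, hx⟩ := heatKernel_pos hα hα' hs (y - z)
    obtain ⟨q, hq, hx'⟩ := heatKernel_pos hα hα' ht z
    rw [hx, hx', ← Complex.ofReal_mul, Complex.norm_real, Real.norm_of_nonneg (by positivity)]
  rw [← cv_heatKernel_heatKernel hα hα' hs ht, cv, integral_congr_ae (.of_forall h),
    integral_complex_ofReal, Complex.norm_real, Real.norm_of_nonneg]
  exact integral_nonneg fun z => norm_nonneg _

/-- The semigroup property of heat flows. -/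
theorem IsHeatFlow.cv_ae_eq {α : ℝ} (hα : 0 < α) (hα' : α < 1) {v : 𝓢'(Sp n, ℂ)}
    {g : ℝ → Sp n → ℂ} (hg : IsHeatFlow α v g) (hm : ∀ t, 0 < t → AEStronglyMeasurable (g t))
    (hb : ∀ t, 0 < t → ∃ B : ℝ, ∀ᵐ x, ‖g t x‖ ≤ B) {s t : ℝ} (hs : 0 < s) (ht : 0 < t) :
    cv (heatKernel α t) (g s) =ᵐ[volume] g (s + t) := by
  obtain ⟨B, hB⟩ := hb s hs
  obtain ⟨B', hB'⟩ := hb (s + t) (by positivity)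
  have hkt := integrable_heatKernel (n := n) hα hα' ht
  have hks := integrable_heatKernel (n := n) hα hα' hs
  have hkct := continuous_heatKernel (n := n) hα hα' ht
  have hkcs := continuous_heatKernel (n := n) hα hα' hs
  refine ae_eq_of_forall_schwartz
    (locallyIntegrable_of_bound (aestronglyMeasurable_cv hkct (hm s hs))
      (.of_forall fun x => norm_cv_le hkt hB x))
    (locallyIntegrable_of_bound (hm _ (by positivity)) hB') fun φ => ?_
  rw [integral_test_cv φ hkt (hm s hs) hB]
  set F : Sp n → ℂ := fun w => v (compSubConstCLM ℂ w φ) with hF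
  obtain ⟨hI, -, hE⟩ := hg (s + t) (by positivity) φ
  -- The product of F with the kernel is measurable by the definition of the flow, and the kernel is
  -- continuous and never zero, so it can be divided out.
  have hFm : AEStronglyMeasurable F := by
    have hk0 : ∀ x : Sp n, heatKernel α s x ≠ 0 := fun x => by
      obtain ⟨p, hp, hx⟩ := heatKernel_pos hα hα' hs x
      rw [hx]; exact_mod_cast hp.ne'
    have h1 := (hg s hs φ).1.aestronglyMeasurable
    have h2 : Continuous fun x : Sp n => (heatKernel α s x)⁻¹ := hkcs.inv₀ hk0
    refine (h2.aestronglyMeasurable.mul h1).congr (.of_forall fun x => ?_)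
    simp only [Pi.mul_apply]
    rw [inv_mul_cancel_left₀ (hk0 x)]
  have hstep : ∀ z : Sp n, ∫ y, compSubConstCLM ℂ (-z) φ y * g s y =
      ∫ y, heatKernel α s y * F (y - z) := by
    intro z
    rw [(hg s hs (compSubConstCLM ℂ (-z) φ)).2.2]
    congr 1; ext y
    rw [hF]; simp only
    rw [compSubConstCLM_comp, neg_add_eq_sub]
  -- Integrating absolute values in z gives exactly the kernel at time s + t times |F|, which is
  -- integrable because the flow exists at that time. No growth bound on F is needed.
  have hprod : Integrable (Function.uncurry fun y z : Sp n =>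
      (heatKernel α s (y - z) * heatKernel α t z) * F y) (volume.prod volume) := by
    have hm : AEStronglyMeasurable (Function.uncurry fun y z : Sp n =>
      (heatKernel α s (y - z) * heatKernel α t z) * F y) (volume.prod volume) := by
      refine AEStronglyMeasurable.mul (Continuous.aestronglyMeasurable ?_) hFm.comp_fst
      fun_prop
    rw [integrable_prod_iff hm]
    refine ⟨.of_forall fun y => ?_, ?_⟩
    · refine Integrable.mul_const ?_ (F y)
      have hb : ∀ z : Sp n, ‖heatKernel α t z‖ ≤ ∫ ξ : Sp n, ‖(heatSymbol α t ξ : ℂ)‖ := by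
        intro z
        rw [heatKernel, Real.fourierInv_eq']
        refine (norm_integral_le_integral_norm _).trans (le_of_eq ?_)
        congr 1; ext ξ
        rw [norm_smul, Complex.norm_exp_ofReal_mul_I, one_mul]
      exact (hks.comp_sub_left y).mul_bdd hkct.aestronglyMeasurable (.of_forall hb)
    · refine hI.norm.congr (.of_forall fun y => ?_)
      simp only [Function.uncurry_apply_pair]
      simp_rw [norm_mul _ (F y)]
      rw [integral_mul_const, integral_norm_heatKernel_mul hα hα' hs ht, norm_mul]
  calc ∫ z, heatKernel α t z * ∫ y, compSubConstCLM ℂ (-z) φ y * g s y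
      = ∫ z, heatKernel α t z * ∫ y, heatKernel α s y * F (y - z) := by simp_rw [hstep]
    _ = ∫ z, heatKernel α t z * ∫ y, heatKernel α s y * F (y + z) := by
        rw [← integral_neg_eq_self]
        congr 1; ext z
        rw [heatKernel_neg hα hα' ht]; simp only [sub_neg_eq_add]
    _ = ∫ z, ∫ y, (heatKernel α s (y - z) * heatKernel α t z) * F y := by
        congr 1; ext z
        rw [← integral_sub_right_eq_self _ z, ← integral_const_mul]
        congr 1; ext y
        rw [sub_add_cancel]; ring
    _ = ∫ y, ∫ z, (heatKernel α s (y - z) * heatKernel α t z) * F y :=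
        (integral_integral_swap hprod).symm
    _ = ∫ y, heatKernel α (s + t) y * F y := by
        congr 1; ext y
        rw [integral_mul_const, ← cv_heatKernel_heatKernel hα hα' hs ht]; rfl
    _ = _ := hE.symm

/-! ### The Duhamel term -/

/-- The constant in the bound of `∫₀ᵀ (T - s)^{-p} s^{-q} ds`. -/
def betaConst (p q : ℝ) : ℝ := 2 ^ p / (1 - q) + 2 ^ q / (1 - p)

lemma betaConst_nonneg {p q : ℝ} (hp : p < 1) (hq : q < 1) : 0 ≤ betaConst p q := by
  unfold betaConst
  have : 0 < 1 - p := by linarith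
  have : 0 < 1 - q := by linarith
  positivity

lemma integrableOn_rpow_neg {q T : ℝ} (hq : q < 1) (hT : 0 < T) :
    IntegrableOn (fun s : ℝ => s ^ (-q)) (Set.Ioo 0 T) ∧
      ∫ s in Set.Ioo 0 T, s ^ (-q) = T ^ (1 - q) / (1 - q) := by
  have h := intervalIntegral.intervalIntegrable_rpow' (a := 0) (b := T) (r := -q) (by linarith)
  rw [intervalIntegrable_iff_integrableOn_Ioo_of_le hT.le] at h
  refine ⟨h, ?_⟩
  rw [← integral_Ioc_eq_integral_Ioo, ← intervalIntegral.integral_of_le hT.le,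
    integral_rpow (Or.inl (by linarith)), show -q + 1 = 1 - q by ring,
    Real.zero_rpow (by linarith : (1 - q) ≠ 0), sub_zero]

lemma integrableOn_sub_rpow_neg {q T : ℝ} (hq : q < 1) (hT : 0 < T) :
    IntegrableOn (fun s : ℝ => (T - s) ^ (-q)) (Set.Ioo 0 T) ∧
      ∫ s in Set.Ioo 0 T, (T - s) ^ (-q) = T ^ (1 - q) / (1 - q) := by
  obtain ⟨h1, h2⟩ := integrableOn_rpow_neg hq hT
  constructor
  · rw [← intervalIntegrable_iff_integrableOn_Ioo_of_le hT.le] at h1 ⊢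
    have := (h1.comp_sub_left T).symm
    simpa using this
  · rw [← h2, ← integral_Ioc_eq_integral_Ioo, ← integral_Ioc_eq_integral_Ioo,
      ← intervalIntegral.integral_of_le hT.le, ← intervalIntegral.integral_of_le hT.le,
      intervalIntegral.integral_comp_sub_left (fun s => s ^ (-q))]
    simp

/-- On each half of the interval, the nonsingular factor is at most its value at T / 2. -/
lemma beta_integral_bound {p q T : ℝ} (hp0 : 0 ≤ p) (hp : p < 1) (hq0 : 0 ≤ q) (hq : q < 1)
    (hT : 0 < T) :
    IntegrableOn (fun s : ℝ => (T - s) ^ (-p) * s ^ (-q)) (Set.Ioo 0 T) ∧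
      ∫ s in Set.Ioo 0 T, (T - s) ^ (-p) * s ^ (-q) ≤ betaConst p q * T ^ (1 - p - q) := by
  obtain ⟨h1, h2⟩ := integrableOn_rpow_neg hq hT
  obtain ⟨h3, h4⟩ := integrableOn_sub_rpow_neg hp hT
  have hdom : IntegrableOn (fun s : ℝ => (T / 2) ^ (-p) * s ^ (-q) + (T / 2) ^ (-q) * (T - s) ^ (-p))
      (Set.Ioo 0 T) := (h1.const_mul _).add (h3.const_mul _)
  have hle : ∀ s ∈ Set.Ioo 0 T, (T - s) ^ (-p) * s ^ (-q) ≤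
      (T / 2) ^ (-p) * s ^ (-q) + (T / 2) ^ (-q) * (T - s) ^ (-p) := by
    intro s hs
    have hs0 : 0 < s := hs.1
    have hs1 : 0 < T - s := sub_pos.2 hs.2
    have hp1 : 0 ≤ s ^ (-q) := by positivity
    have hp2 : 0 ≤ (T - s) ^ (-p) := by positivity
    rcases le_total s (T / 2) with h | h
    · have : (T - s) ^ (-p) ≤ (T / 2) ^ (-p) :=
        Real.rpow_le_rpow_of_nonpos (by positivity) (by linarith) (by linarith)
      have h5 : 0 ≤ (T / 2) ^ (-q) * (T - s) ^ (-p) := by positivity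
      nlinarith
    · have : s ^ (-q) ≤ (T / 2) ^ (-q) :=
        Real.rpow_le_rpow_of_nonpos (by positivity) (by linarith) (by linarith)
      have h5 : 0 ≤ (T / 2) ^ (-p) * s ^ (-q) := by positivity
      nlinarith
  have hI : IntegrableOn (fun s : ℝ => (T - s) ^ (-p) * s ^ (-q)) (Set.Ioo 0 T) := by
    refine Integrable.mono' hdom (Measurable.aestronglyMeasurable (by fun_prop)) ?_
    refine (ae_restrict_iff' measurableSet_Ioo).2 (.of_forall fun s hs => ?_)
    have hs0 : 0 < s := hs.1
    have hs1 : 0 < T - s := sub_pos.2 hs.2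
    rw [Real.norm_of_nonneg (by positivity)]
    exact hle s hs
  refine ⟨hI, (setIntegral_mono_on hI hdom measurableSet_Ioo hle).trans (le_of_eq ?_)⟩
  rw [integral_add (h1.const_mul _) (h3.const_mul _), integral_const_mul, integral_const_mul, h2, h4,
    betaConst, Real.div_rpow hT.le two_pos.le, Real.div_rpow hT.le two_pos.le,
    Real.rpow_neg two_pos.le, Real.rpow_neg two_pos.le,
    show 1 - p - q = -p + (1 - q) by ring, Real.rpow_add hT]
  have : T ^ (-q) * T ^ (1 - p) = T ^ (-p) * T ^ (1 - q) := by
    rw [← Real.rpow_add hT, ← Real.rpow_add hT]; congr 1; ring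
  calc _ = 2 ^ p * (T ^ (-p) * T ^ (1 - q)) / (1 - q) + 2 ^ q * (T ^ (-q) * T ^ (1 - p)) / (1 - p) := by
        rw [div_inv_eq_mul, div_inv_eq_mul]; ring
    _ = _ := by rw [this]; ring

/-- The decay exponent of the space `GX`. -/
def decayExp (α : ℝ) : ℝ := 1 - 1 / (2 * α)

lemma decayExp_pos {α : ℝ} (hα : 1 / 2 < α) : 0 < decayExp α := by
  unfold decayExp
  have : 1 / (2 * α) < 1 := by rw [div_lt_one (by linarith)]; linarith
  linarith

/-- Makes the decay rate of |u|² integrable at time zero. -/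
lemma two_mul_decayExp_lt_one {α : ℝ} (hα : 0 < α) (hα' : α < 1) : 2 * decayExp α < 1 := by
  unfold decayExp
  have : 1 / 2 < 1 / (2 * α) := by
    rw [div_lt_div_iff₀ (by norm_num) (by linarith)]; linarith
  linarith

/-- The bilinear Duhamel integral over `(0, t₀)` observed at time `T ≥ t₀`. -/
def duhamelPart (α : ℝ) (i j k : Fin n) (f : ℝ → Sp n → ℂ) (T t₀ : ℝ) (x : Sp n) : ℂ :=
  ∫ s in Set.Ioo 0 t₀, cv (projKernel α i j k (T - s)) (f s) x

/-- A measurable density with the decay of a product of two elements of `GX`. -/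
structure IsSource (α B : ℝ) (f : ℝ → Sp n → ℂ) : Prop where
  meas : Measurable (Function.uncurry f)
  bound : ∀ s, 0 < s → ∀ y, ‖f s y‖ ≤ B * s ^ (-(2 * decayExp α))

section

variable {α B : ℝ} {f : ℝ → Sp n → ℂ} {i j k : Fin n}

lemma IsSource.slice (hf : IsSource α B f) (s : ℝ) : AEStronglyMeasurable (f s) volume :=
  (hf.meas.comp measurable_prodMk_left).aestronglyMeasurable

lemma IsSource.nonneg (hf : IsSource α B f) : 0 ≤ B := by
  have := hf.bound 1 one_pos 0
  rw [Real.one_rpow, mul_one] at this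
  exact (norm_nonneg _).trans this

lemma IsSource.stronglyMeasurable_cv (hf : IsSource α B f) (i j k : Fin n) (T : ℝ) :
    StronglyMeasurable (fun p : ℝ × Sp n => cv (projKernel α i j k (T - p.1)) (f p.1) p.2) := by
  have hK := measurable_projKernel α i j k
  generalize projKernel α i j k = K at hK ⊢
  have h : StronglyMeasurable (fun q : (ℝ × Sp n) × Sp n =>
      K (T - q.1.1) (q.1.2 - q.2) * f q.1.1 q.2) := by
    refine Measurable.stronglyMeasurable (Measurable.mul ?_ ?_)
    · exact hK.comp (by fun_prop : Measurable fun q : (ℝ × Sp n) × Sp n => (T - q.1.1, q.1.2 - q.2))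
    · exact hf.meas.comp (by fun_prop : Measurable fun q : (ℝ × Sp n) × Sp n => (q.1.1, q.2))
  exact h.integral_prod_right' (ν := volume)

lemma IsSource.norm_cv_le (hα : 0 < α) (hα' : α < 1) (hf : IsSource α B f) (i j k : Fin n)
    {T s : ℝ} (hs : 0 < s) (hsT : s < T) (x : Sp n) :
    ‖cv (projKernel α i j k (T - s)) (f s) x‖ ≤
      projConst n α * B * ((T - s) ^ (-(1 / (2 * α))) * s ^ (-(2 * decayExp α))) := by
  obtain ⟨-, h2, h3⟩ := (projConst_spec (n := n) hα hα').2 i j k (T - s) (sub_pos.2 hsT)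
  have := hf.nonneg
  calc _ ≤ (∫ x, ‖projKernel α i j k (T - s) x‖) * (B * s ^ (-(2 * decayExp α))) :=
        FracNS.norm_cv_le h2 (.of_forall (hf.bound s hs)) x
    _ ≤ (projConst n α * (T - s) ^ (-(1 / (2 * α)))) * (B * s ^ (-(2 * decayExp α))) := by gcongr
    _ = _ := by ring

/-- The constant in the Duhamel bound. -/
def duhamelConst (n : ℕ) (α : ℝ) : ℝ :=
  projConst n α * betaConst (1 / (2 * α)) (2 * decayExp α)

/-- The scaling identity 1 - 1/(2α) - 2β = -β: the bilinear term reproduces the decay of `GX`. -/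
lemma source_weight (hα : 1 / 2 < α) (hα' : α < 1) {T : ℝ} (hT : 0 < T) :
    IntegrableOn (fun s : ℝ => (T - s) ^ (-(1 / (2 * α))) * s ^ (-(2 * decayExp α))) (Set.Ioo 0 T) ∧
      ∫ s in Set.Ioo 0 T, (T - s) ^ (-(1 / (2 * α))) * s ^ (-(2 * decayExp α)) ≤
        betaConst (1 / (2 * α)) (2 * decayExp α) * T ^ (-decayExp α) := by
  have h0 := decayExp_pos hα
  have h1 := two_mul_decayExp_lt_one (by linarith) hα'
  have h := beta_integral_bound (p := 1 / (2 * α)) (q := 2 * decayExp α) (by positivity)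
    (by unfold decayExp at h0; linarith) (by linarith) h1 hT
  rwa [show 1 - 1 / (2 * α) - 2 * decayExp α = -decayExp α by unfold decayExp; ring] at h

lemma duhamelConst_nonneg (hα : 1 / 2 < α) (hα' : α < 1) : 0 ≤ duhamelConst n α := by
  have h0 := decayExp_pos hα
  refine mul_nonneg (projConst_spec (by linarith) hα').1 (betaConst_nonneg ?_
    (two_mul_decayExp_lt_one (by linarith) hα'))
  unfold decayExp at h0; linarith

lemma IsSource.integrableOn_cv (hα : 1 / 2 < α) (hα' : α < 1) (hf : IsSource α B f)
    (i j k : Fin n) {T t₀ : ℝ} (ht₀ : 0 < t₀) (hT : t₀ ≤ T) (x : Sp n) :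
    IntegrableOn (fun s => cv (projKernel α i j k (T - s)) (f s) x) (Set.Ioo 0 t₀) := by
  have hw := ((source_weight hα hα' (ht₀.trans_le hT)).1.mono_set
    (Set.Ioo_subset_Ioo_right hT)).const_mul (projConst n α * B)
  refine Integrable.mono' hw ?_ ?_
  · exact ((hf.stronglyMeasurable_cv i j k T).comp_measurable
      (by fun_prop : Measurable fun s : ℝ => (s, x))).aestronglyMeasurable
  · refine (ae_restrict_iff' measurableSet_Ioo).2 (.of_forall fun s hs => ?_)
    exact hf.norm_cv_le (by linarith) hα' i j k hs.1 (hs.2.trans_le hT) x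

/-- The dominating integrand is nonnegative, so (0, t₀) may be enlarged to (0, T); this keeps the
bound free of t₀. -/
lemma IsSource.norm_duhamelPart_le (hα : 1 / 2 < α) (hα' : α < 1) (hf : IsSource α B f)
    (i j k : Fin n) {T t₀ : ℝ} (ht₀ : 0 < t₀) (hT : t₀ ≤ T) (x : Sp n) :
    ‖duhamelPart α i j k f T t₀ x‖ ≤ duhamelConst n α * B * T ^ (-decayExp α) := by
  have hT0 := ht₀.trans_le hT
  obtain ⟨hw, hw2⟩ := source_weight hα hα' hT0
  have hP := (projConst_spec (n := n) (α := α) (by linarith) hα').1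
  have hB := hf.nonneg
  calc _ ≤ ∫ s in Set.Ioo 0 t₀, projConst n α * B *
        ((T - s) ^ (-(1 / (2 * α))) * s ^ (-(2 * decayExp α))) := by
        refine norm_integral_le_of_norm_le ((hw.mono_set
          (Set.Ioo_subset_Ioo_right hT)).const_mul _) ?_
        refine (ae_restrict_iff' measurableSet_Ioo).2 (.of_forall fun s hs => ?_)
        exact hf.norm_cv_le (by linarith) hα' i j k hs.1 (hs.2.trans_le hT) x
    _ = projConst n α * B * ∫ s in Set.Ioo 0 t₀,
        ((T - s) ^ (-(1 / (2 * α))) * s ^ (-(2 * decayExp α))) := integral_const_mul _ _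
    _ ≤ projConst n α * B * ∫ s in Set.Ioo 0 T,
        ((T - s) ^ (-(1 / (2 * α))) * s ^ (-(2 * decayExp α))) := by
        refine mul_le_mul_of_nonneg_left (setIntegral_mono_set hw ?_
          (Set.Ioo_subset_Ioo_right hT).eventuallyLE) (by positivity)
        refine (ae_restrict_iff' measurableSet_Ioo).2 (.of_forall fun s hs => ?_)
        have hs0 : 0 < s := hs.1
        have hs1 : 0 < T - s := sub_pos.2 hs.2
        simp only [Pi.zero_apply]; positivity
    _ ≤ projConst n α * B * (betaConst (1 / (2 * α)) (2 * decayExp α) * T ^ (-decayExp α)) := by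
        gcongr
    _ = _ := by unfold duhamelConst; ring

lemma IsSource.aestronglyMeasurable_duhamelPart (hf : IsSource α B f) (i j k : Fin n) (T t₀ : ℝ) :
    AEStronglyMeasurable (duhamelPart α i j k f T t₀) := by
  have h := (hf.stronglyMeasurable_cv i j k T).integral_prod_left'
    (μ := volume.restrict (Set.Ioo 0 t₀))
  exact h.aestronglyMeasurable

/-- The heat semigroup moves the observation time of a Duhamel integral. -/
lemma IsSource.cv_duhamelPart (hα : 1 / 2 < α) (hα' : α < 1) (hf : IsSource α B f)
    (i j k : Fin n) {t t₀ : ℝ} (ht : 0 < t) (ht₀ : 0 < t₀) (x : Sp n) :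
    cv (heatKernel α t) (duhamelPart α i j k f t₀ t₀) x =
      duhamelPart α i j k f (t + t₀) t₀ x := by
  have hα0 : 0 < α := by linarith
  have hk := integrable_heatKernel (n := n) hα0 hα' ht
  have hkc := continuous_heatKernel (n := n) hα0 hα' ht
  have hI : Integrable (Function.uncurry fun (y : Sp n) (s : ℝ) =>
      heatKernel α t (x - y) * cv (projKernel α i j k (t₀ - s)) (f s) y)
      (volume.prod (volume.restrict (Set.Ioo 0 t₀))) := by
    have hw := (source_weight hα hα' ht₀).1.const_mul (projConst n α * B)
    have h1 := (hk.comp_sub_left x).norm.mul_prod hw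
    refine Integrable.mono' h1 ?_ ?_
    · refine AEStronglyMeasurable.mul ?_ ?_
      · exact Continuous.aestronglyMeasurable (by fun_prop)
      · exact ((hf.stronglyMeasurable_cv i j k t₀).comp_measurable measurable_swap).aestronglyMeasurable
    · have h2 : ∀ᵐ p : Sp n × ℝ ∂(volume.prod (volume.restrict (Set.Ioo 0 t₀))),
          p.2 ∈ Set.Ioo 0 t₀ :=
        Measure.quasiMeasurePreserving_snd.ae (ae_restrict_mem measurableSet_Ioo)
      filter_upwards [h2] with p hp
      simp only [Function.uncurry, norm_mul]
      gcongr
      exact hf.norm_cv_le hα0 hα' i j k hp.1 hp.2 p.1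
  calc cv (heatKernel α t) (duhamelPart α i j k f t₀ t₀) x
      = ∫ y, ∫ s in Set.Ioo 0 t₀,
          heatKernel α t (x - y) * cv (projKernel α i j k (t₀ - s)) (f s) y := by
        rw [cv]; congr 1; ext y; rw [duhamelPart, integral_const_mul]
    _ = ∫ s in Set.Ioo 0 t₀, ∫ y,
          heatKernel α t (x - y) * cv (projKernel α i j k (t₀ - s)) (f s) y :=
        integral_integral_swap hI
    _ = _ := by
        refine setIntegral_congr_fun measurableSet_Ioo fun s hs => ?_
        have hs1 : 0 < t₀ - s := sub_pos.2 hs.2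
        have h := cv_cv hk hkc ((projConst_spec (n := n) hα0 hα').2 i j k _ hs1).2.1
          (continuous_projKernel hα0 hα' i j k hs1) (hf.slice s) (.of_forall (hf.bound s hs.1)) x
        rw [cv_heatKernel_projKernel hα0 hα' i j k ht hs1] at h
        rw [show t + t₀ - s = t + (t₀ - s) by ring, ← h]; rfl

end

section

variable {α : ℝ} {u : ℝ → Sp n → Sp n}

/-! ### Mild solutions in `GX` -/

lemma MemGX.ae_norm_le (hu : MemGX α u) {t : ℝ} (ht : 0 < t) :
    ∀ᵐ x, ‖u t x‖ ≤ (gxNorm α u).toReal * t ^ (-decayExp α) := by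
  have h1 : ENNReal.ofReal (t ^ decayExp α) * eLpNorm (u t) ⊤ volume ≤ gxNorm α u :=
    le_iSup₂ (f := fun (t : ℝ) (_ : 0 < t) =>
      ENNReal.ofReal (t ^ (1 - 1 / (2 * α))) * eLpNorm (u t) ⊤ volume) t ht
  have hpos : 0 < t ^ decayExp α := by positivity
  rw [eLpNorm_exponent_top] at h1
  filter_upwards [ae_le_eLpNormEssSup (f := u t) (μ := volume)] with x hx
  have h2 : ENNReal.ofReal (t ^ decayExp α) * ‖u t x‖ₑ ≤ gxNorm α u :=
    (mul_le_mul_right hx _).trans h1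
  have h3 := ENNReal.toReal_mono hu.norm_lt_top.ne h2
  rw [ENNReal.toReal_mul, ENNReal.toReal_ofReal hpos.le, toReal_enorm] at h3
  rw [Real.rpow_neg ht.le, ← div_eq_mul_inv, le_div_iff₀ hpos]
  linarith

lemma norm_coord_le (v : Sp n) (i : Fin n) : ‖((v i : ℝ) : ℂ)‖ ≤ ‖v‖ := by
  rw [Complex.norm_real]; exact PiLp.norm_apply_le v i

lemma MemGX.coord_aestronglyMeasurable (hu : MemGX α u) {t : ℝ} (ht : 0 < t) (i : Fin n) :
    AEStronglyMeasurable (fun x => (u t x i : ℂ)) volume := by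
  have h : Continuous fun v : Sp n => ((v i : ℝ) : ℂ) := by fun_prop
  exact h.comp_aestronglyMeasurable (hu.aesm_slice t ht)

/-- The products `u_j u_k` have measurable representatives with pointwise bounds. -/
lemma MemGX.exists_source (hu : MemGX α u) :
    ∃ f : Fin n → Fin n → ℝ → Sp n → ℂ,
      (∀ j k, IsSource α ((gxNorm α u).toReal ^ 2) (f j k)) ∧
      ∀ᵐ s ∂(volume.restrict (Set.Ioi (0 : ℝ))), ∀ j k, ∀ᵐ y,
        f j k s y = (u s y j : ℂ) * (u s y k : ℂ) := by
  set M := (gxNorm α u).toReal with hM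
  have hM0 : 0 ≤ M := ENNReal.toReal_nonneg
  set w := hu.aesm.mk (Function.uncurry u) with hw
  have hwm : Measurable w := hu.aesm.stronglyMeasurable_mk.measurable
  have hae : ∀ᵐ s ∂(volume.restrict (Set.Ioi (0 : ℝ))), ∀ᵐ y, u s y = w (s, y) :=
    Measure.ae_ae_of_ae_prod hu.aesm.ae_eq_mk
  -- The jointly measurable representative is set to zero where it exceeds the bound of its time
  -- slice. The bound then holds everywhere, and for almost every s the slice changes only on a null
  -- set.
  refine ⟨fun j k s y => if ‖w (s, y)‖ ≤ M * s ^ (-decayExp α) then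
    (w (s, y) j : ℂ) * (w (s, y) k : ℂ) else 0, fun j k => ⟨?_, ?_⟩, ?_⟩
  · unfold Function.uncurry
    refine Measurable.ite (measurableSet_le (by fun_prop) (by fun_prop)) ?_ measurable_const
    fun_prop
  · intro s hs y
    have hpow : M ^ 2 * s ^ (-(2 * decayExp α)) = (M * s ^ (-decayExp α)) ^ 2 := by
      rw [mul_pow, ← Real.rpow_natCast (s ^ (-decayExp α)), ← Real.rpow_mul hs.le]
      congr 2; push_cast; ring
    rw [hpow]
    simp only
    split_ifs with h
    · rw [norm_mul, sq]
      gcongr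
      · exact (norm_coord_le _ _).trans h
      · exact (norm_coord_le _ _).trans h
    · rw [norm_zero]; positivity
  · filter_upwards [hae, ae_restrict_mem measurableSet_Ioi] with s hs hs0 j k
    filter_upwards [hs, hu.ae_norm_le hs0] with y hy hy2
    rw [← hy, if_pos hy2]

/-- The exceptional null sets disappear under the integrals in s and y, so the identity holds at
every point x. -/
lemma duhamel_eq_sum (hα : 1 / 2 < α) (hα' : α < 1)
    {f : Fin n → Fin n → ℝ → Sp n → ℂ} {B : ℝ} (hf : ∀ j k, IsSource α B (f j k))
    (hfu : ∀ᵐ s ∂(volume.restrict (Set.Ioi (0 : ℝ))), ∀ j k, ∀ᵐ y,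
        f j k s y = (u s y j : ℂ) * (u s y k : ℂ)) (i : Fin n) {t : ℝ} (ht : 0 < t) (x : Sp n) :
    duhamel α u i t x = ∑ j, ∑ k, duhamelPart α i j k (f j k) t t x := by
  have hfu' : ∀ᵐ s ∂(volume.restrict (Set.Ioo (0 : ℝ) t)), ∀ j k, ∀ᵐ y,
        f j k s y = (u s y j : ℂ) * (u s y k : ℂ) :=
    ae_restrict_of_ae_restrict_of_subset (fun s hs => hs.1) hfu
  have h1 : duhamel α u i t x = ∫ s in Set.Ioo 0 t, ∑ j, ∑ k,
      cv (projKernel α i j k (t - s)) (f j k s) x := by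
    refine integral_congr_ae ?_
    filter_upwards [hfu', ae_restrict_mem measurableSet_Ioo] with s hs hst
    have hI : ∀ j k, Integrable (fun y => projKernel α i j k (t - s) (x - y) * f j k s y) :=
      fun j k => integrable_cv
        ((projConst_spec (n := n) (by linarith) hα').2 i j k _ (sub_pos.2 hst.2)).2.1
        ((hf j k).slice s) (.of_forall ((hf j k).bound s hst.1)) x
    calc _ = ∫ y : Sp n, ∑ j, ∑ k, projKernel α i j k (t - s) (x - y) * f j k s y := by
          refine integral_congr_ae ?_
          have : ∀ᵐ y, ∀ j k, f j k s y = (u s y j : ℂ) * (u s y k : ℂ) := by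
            rw [ae_all_iff]; intro j; rw [ae_all_iff]; exact hs j
          filter_upwards [this] with y hy
          simp_rw [hy]
      _ = _ := by
          rw [integral_finsetSum _ fun j _ => integrable_finsetSum _ fun k _ => hI j k]
          refine Finset.sum_congr rfl fun j _ => ?_
          rw [integral_finsetSum _ fun k _ => hI j k]
          rfl
  have hJ : ∀ j k, IntegrableOn (fun s => cv (projKernel α i j k (t - s)) (f j k s) x)
      (Set.Ioo 0 t) := fun j k => (hf j k).integrableOn_cv hα hα' i j k ht le_rfl x
  rw [h1, integral_finsetSum _ fun j _ => integrable_finsetSum _ fun k _ => hJ j k]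
  refine Finset.sum_congr rfl fun j _ => ?_
  rw [integral_finsetSum _ fun k _ => hJ j k]
  rfl

lemma cv_sum {ι : Type*} (S : Finset ι) {k : Sp n → ℂ} {f : ι → Sp n → ℂ} {B : ι → ℝ}
    (hk : Integrable k) (hf : ∀ a ∈ S, AEStronglyMeasurable (f a))
    (hB : ∀ a ∈ S, ∀ᵐ x, ‖f a x‖ ≤ B a) (x : Sp n) :
    cv k (fun y => ∑ a ∈ S, f a y) x = ∑ a ∈ S, cv k (f a) x := by
  simp only [cv]
  rw [← integral_finsetSum _ fun a ha => integrable_cv hk (hf a ha) (hB a ha) x]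
  congr 1; ext y; rw [Finset.mul_sum]

/-- The constant in the bound of the heat flow of a mild solution. -/
def mildConst (n : ℕ) (α : ℝ) : ℝ := 1 + 2 * (n * n * duhamelConst n α)

/-- The heat flow of `u(t₀)` decays like an element of `GX`. -/
theorem norm_heat_mild_le (hα : 1 / 2 < α) (hα' : α < 1) {u₀ : Fin n → 𝓢'(Sp n, ℂ)}
    (hu : MemGX α u) (hmild : IsMildSolution α u₀ u) {t₀ : ℝ} (ht₀ : 0 < t₀) (i : Fin n)
    {t : ℝ} (ht : 0 < t) :
    ∀ᵐ x, ‖cv (heatKernel α t) (fun y => (u t₀ y i : ℂ)) x‖ ≤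
      mildConst n α * ((gxNorm α u).toReal + (gxNorm α u).toReal ^ 2) * t ^ (-decayExp α) := by
  set M := (gxNorm α u).toReal with hM
  have hM0 : 0 ≤ M := ENNReal.toReal_nonneg
  have hα0 : 0 < α := by linarith
  have hβ := decayExp_pos hα
  obtain ⟨f, hf, hfu⟩ := hu.exists_source
  have hk := integrable_heatKernel (n := n) hα0 hα' ht
  set d := duhamelConst n α with hd
  have hd0 : 0 ≤ d := duhamelConst_nonneg hα hα'
  have hDfun : ∀ t, 0 < t → duhamel α u i t =
      fun x => ∑ j, ∑ k, duhamelPart α i j k (f j k) t t x := fun t ht => by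
    ext x; exact duhamel_eq_sum hα hα' hf hfu i ht x
  have hsum : ∀ T t₁ : ℝ, 0 < t₁ → t₁ ≤ T → ∀ x,
      ‖∑ j, ∑ k, duhamelPart α i j k (f j k) T t₁ x‖ ≤ n * n * d * M ^ 2 * T ^ (-decayExp α) := by
    intro T t₁ h1 h2 x
    calc _ ≤ ∑ j : Fin n, ∑ k : Fin n, d * M ^ 2 * T ^ (-decayExp α) :=
          norm_sum_le_of_le _ fun j _ => norm_sum_le_of_le _ fun k _ =>
            (hf j k).norm_duhamelPart_le hα hα' i j k h1 h2 x
      _ = _ := by simp; ring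
  have hDm : ∀ t, 0 < t → AEStronglyMeasurable (duhamel α u i t) volume := by
    intro t ht
    rw [hDfun t ht]
    refine Finset.aestronglyMeasurable_fun_sum _ fun j _ =>
      Finset.aestronglyMeasurable_fun_sum _ fun k _ => ?_
    exact (hf j k).aestronglyMeasurable_duhamelPart i j k t t
  have hDb : ∀ t, 0 < t → ∀ x, ‖duhamel α u i t x‖ ≤ n * n * d * M ^ 2 * t ^ (-decayExp α) := by
    intro t ht x
    rw [hDfun t ht]; exact hsum t t ht le_rfl x
  have hub : ∀ t, 0 < t → ∀ᵐ x, ‖(u t x i : ℂ)‖ ≤ M * t ^ (-decayExp α) := by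
    intro t ht
    filter_upwards [hu.ae_norm_le ht] with x hx
    exact (norm_coord_le _ _).trans hx
  have hum : ∀ t, 0 < t → AEStronglyMeasurable (fun x => (u t x i : ℂ)) volume := fun t ht =>
    hu.coord_aestronglyMeasurable ht i
  -- S(t) carries u + D at time t₀ to u + D at time t₀ + t, which eliminates the initial data.
  have hflow := (hmild i).cv_ae_eq hα0 hα' (fun t ht => (hum t ht).add (hDm t ht))
    (fun t ht => ⟨M * t ^ (-decayExp α) + n * n * d * M ^ 2 * t ^ (-decayExp α), by
      filter_upwards [hub t ht] with x hx
      exact (norm_add_le _ _).trans (add_le_add hx (hDb t ht x))⟩) ht₀ ht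
  have hcvD : ∀ x, cv (heatKernel α t) (duhamel α u i t₀) x =
      ∑ j, ∑ k, duhamelPart α i j k (f j k) (t + t₀) t₀ x := by
    intro x
    have hm : ∀ j k, AEStronglyMeasurable (duhamelPart α i j k (f j k) t₀ t₀) volume := fun j k =>
      (hf j k).aestronglyMeasurable_duhamelPart i j k t₀ t₀
    have hb : ∀ j k, ∀ᵐ x, ‖duhamelPart α i j k (f j k) t₀ t₀ x‖ ≤
        d * M ^ 2 * t₀ ^ (-decayExp α) := fun j k => .of_forall fun x =>
      (hf j k).norm_duhamelPart_le hα hα' i j k ht₀ le_rfl x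
    rw [hDfun t₀ ht₀, cv_sum (B := fun _ => ∑ k : Fin n, d * M ^ 2 * t₀ ^ (-decayExp α)) _ hk
      (fun j _ => Finset.aestronglyMeasurable_fun_sum _ fun k _ => hm j k) (fun j _ => ?_)]
    · refine Finset.sum_congr rfl fun j _ => ?_
      rw [cv_sum (B := fun _ => d * M ^ 2 * t₀ ^ (-decayExp α)) _ hk (fun k _ => hm j k)
        (fun k _ => hb j k)]
      exact Finset.sum_congr rfl fun k _ => (hf j k).cv_duhamelPart hα hα' i j k ht ht₀ x
    · exact .of_forall fun x => norm_sum_le_of_le _ fun k _ =>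
        (hf j k).norm_duhamelPart_le hα hα' i j k ht₀ le_rfl x
  have hmono : (t + t₀) ^ (-decayExp α) ≤ t ^ (-decayExp α) :=
    Real.rpow_le_rpow_of_nonpos ht (by linarith) (by linarith)
  filter_upwards [hflow, hub (t₀ + t) (by positivity)] with x hx hux
  rw [cv_add hk (hum t₀ ht₀) (hDm t₀ ht₀) (hub t₀ ht₀) (.of_forall (hDb t₀ ht₀)), hcvD] at hx
  have h1 := hDb (t₀ + t) (by positivity) x
  have h2 := hsum (t + t₀) t₀ ht₀ (by linarith) x
  rw [add_comm t₀ t] at hux h1 hx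
  -- What remains is u(t + t₀), plus the full Duhamel term at t + t₀, minus its part over (0, t₀):
  -- hence the 1 and the factor 2 in `mildConst`.
  rw [eq_sub_of_add_eq hx]
  have hn : (0 : ℝ) ≤ n := Nat.cast_nonneg n
  calc _ ≤ M * (t + t₀) ^ (-decayExp α) + n * n * d * M ^ 2 * (t + t₀) ^ (-decayExp α) +
        n * n * d * M ^ 2 * (t + t₀) ^ (-decayExp α) :=
        (norm_sub_le _ _).trans (add_le_add ((norm_add_le _ _).trans (add_le_add hux h1)) h2)
    _ = (M + 2 * (n * n * d) * M ^ 2) * (t + t₀) ^ (-decayExp α) := by ring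
    _ ≤ (mildConst n α * (M + M ^ 2)) * t ^ (-decayExp α) := by
        have hC : 0 ≤ mildConst n α := by rw [mildConst, ← hd]; positivity
        refine mul_le_mul ?_ hmono (by positivity) (by positivity)
        rw [mildConst, ← hd]
        have h3 : 0 ≤ 2 * (n * n * d) * M := by positivity
        have h4 : 0 ≤ M ^ 2 := by positivity
        nlinarith
    _ = _ := by ring

end

/-! ### Fourier multipliers of bounded functions -/

lemma exists_represents {f : Sp n → ℂ} {B : ℝ} (hf : AEStronglyMeasurable f)
    (hB : ∀ᵐ x, ‖f x‖ ≤ B) : ∃ v : 𝓢'(Sp n, ℂ), Represents f v := by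
  have hmem : MemLp f ⊤ volume := memLp_top_of_bound hf B hB
  refine ⟨Lp.toTemperedDistribution (hmem.toLp f), fun φ => ⟨integrable_schwartz_mul φ hf hB, ?_⟩⟩
  rw [Lp.toTemperedDistribution_apply]
  refine integral_congr_ae ?_
  filter_upwards [hmem.coeFn_toLp] with x hx
  rw [hx, smul_eq_mul]

lemma linftyNorm_le_of_represents {h : Sp n → ℂ} {w : 𝓢'(Sp n, ℂ)} {L : ℝ} (hw : Represents h w)
    (hm : AEStronglyMeasurable h) (hL : ∀ᵐ x, ‖h x‖ ≤ L) : linftyNorm w ≤ ENNReal.ofReal L := by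
  refine (iInf₂_le h ⟨memLp_top_of_bound hm L hL, hw⟩).trans ?_
  rw [eLpNorm_exponent_top]
  refine eLpNormEssSup_le_of_ae_enorm_bound ?_
  filter_upwards [hL] with x hx
  rw [← ofReal_norm]
  exact ENNReal.ofReal_le_ofReal hx

/-- Describes the action of the multiplier on test functions, by which it acts on distributions; it
is `cv_fourierInv` applied to the reflection of φ. -/
lemma fourier_mul_fourierInv_schwartz {g : Sp n → ℂ} (hg : Integrable g) (φ : 𝓢(Sp n, ℂ))
    (y : Sp n) :
    𝓕 (fun ξ => g ξ * 𝓕⁻ (φ : Sp n → ℂ) ξ) y = ∫ z, φ (z + y) * 𝓕⁻ g z := by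
  have hk : Integrable (fun z => φ (-z)) := φ.integrable.comp_neg
  have h := cv_fourierInv hk hg (-y)
  have h2 : 𝓕 (fun z : Sp n => φ (-z)) = 𝓕⁻ (φ : Sp n → ℂ) := by
    rw [Real.fourierInv_eq_fourier_comp_neg]
  rw [h2, Real.fourierInv_eq_fourier_neg, neg_neg] at h
  rw [show (fun ξ => g ξ * 𝓕⁻ (φ : Sp n → ℂ) ξ) = fun ξ => 𝓕⁻ (φ : Sp n → ℂ) ξ * g ξ by
    ext ξ; ring, ← h, cv]
  congr 1; ext z
  rw [show -(-y - z) = z + y by abel]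

lemma represents_fourierMultiplier {f : Sp n → ℂ} {B : ℝ} (hf : AEStronglyMeasurable f)
    (hB : ∀ᵐ x, ‖f x‖ ≤ B) {v : 𝓢'(Sp n, ℂ)} (hv : Represents f v) {g : Sp n → ℂ}
    (hg : g.HasTemperateGrowth) (hgi : Integrable g) (hgi' : Integrable (𝓕⁻ g)) :
    Represents (cv (𝓕⁻ g) f) (TemperedDistribution.fourierMultiplierCLM ℂ g v) := by
  intro φ
  have hc := continuous_fourierInv hgi
  refine ⟨integrable_schwartz_mul φ (aestronglyMeasurable_cv hc hf)
    (.of_forall fun x => norm_cv_le hgi' hB x), ?_⟩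
  rw [TemperedDistribution.fourierMultiplierCLM_apply_apply, (hv _).2, integral_test_cv φ hgi' hf hB]
  have hI := integrable_test_cv φ hgi' hf hB
  calc _ = ∫ y, ∫ z, (φ (z + y) * 𝓕⁻ g z) * f y := by
        congr 1; ext y
        rw [integral_mul_const, ← fourier_mul_fourierInv_schwartz hgi φ y, SchwartzMap.fourier_coe]
        refine congrArg (· * f y) (congrArg (fun h : Sp n → ℂ => 𝓕 h y) (funext fun ξ => ?_))
        rw [SchwartzMap.smulLeftCLM_apply_apply hg, SchwartzMap.fourierInv_coe, smul_eq_mul]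
    _ = ∫ z, ∫ y, (φ (z + y) * 𝓕⁻ g z) * f y := (integral_integral_swap hI).symm
    _ = _ := by
        congr 1; ext z
        rw [← integral_const_mul]
        congr 1; ext y
        rw [compSubConstCLM_apply, sub_neg_eq_add, add_comm y z]; ring

section Dilates

variable {g : Sp n → ℂ}

lemma contDiff_dilate (hg : ContDiff ℝ (⊤ : ℕ∞) g) (c : ℝ) :
    ContDiff ℝ (⊤ : ℕ∞) (fun ξ => g (c • ξ)) := hg.comp (contDiff_const_smul c)

lemma hasCompactSupport_dilate (hg : HasCompactSupport g) {c : ℝ} (hc : c ≠ 0) :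
    HasCompactSupport (fun ξ => g (c • ξ)) := hg.comp_smul hc

lemma integrable_of_test (hg : ContDiff ℝ (⊤ : ℕ∞) g) (hc : HasCompactSupport g) :
    Integrable g ∧ Integrable (𝓕⁻ g) :=
  ⟨hg.continuous.integrable_of_hasCompactSupport hc,
    integrable_fourierInv_of_schwartz (hc.toSchwartzMap hg) fun _ => rfl⟩

lemma fourier_fourierInv_of_test (hg : ContDiff ℝ (⊤ : ℕ∞) g) (hc : HasCompactSupport g) :
    𝓕 (𝓕⁻ g) = g := by
  refine hg.continuous.fourier_fourierInv_eq (integrable_of_test hg hc).1 ?_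
  have h2 : 𝓕 g = fun x => 𝓕⁻ g (-x) := by
    ext x; rw [Real.fourierInv_eq_fourier_neg, neg_neg]
  rw [h2]; exact (integrable_of_test hg hc).2.comp_neg

/-- Makes the later bounds uniform over dyadic scales and over λ. -/
lemma integral_norm_fourierInv_dilate (g : Sp n → ℂ) {c : ℝ} (hc : 0 < c) :
    ∫ x, ‖𝓕⁻ (fun ξ => g (c • ξ)) x‖ = ∫ x, ‖𝓕⁻ g x‖ := by
  simp_rw [fourierInv_comp_smul g hc, norm_mul, Complex.norm_real]
  rw [integral_const_mul, integral_norm_comp_dilate _ (inv_pos.2 hc),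
    Real.norm_of_nonneg (by positivity), inv_pow, inv_inv, inv_mul_cancel_left₀ (by positivity)]

end Dilates

/-! ### Littlewood-Paley blocks -/

/-- `ψ(ξ) exp((2π|ξ|)^{2α})`, so that `ψ(D) = a(D) S(1)`. -/
def unheated (α : ℝ) (ψ : Sp n → ℂ) (ξ : Sp n) : ℂ :=
  ψ ξ * (Real.exp ((2 * Real.pi * ‖ξ‖) ^ (2 * α)) : ℂ)

/-- The power of |ξ| can be singular only at the origin, and ψ vanishes near it. -/
lemma unheated_contDiff (α : ℝ) {ψ : Sp n → ℂ} (hψ : IsDyadicPartition ψ) :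
    ContDiff ℝ (⊤ : ℕ∞) (unheated α ψ) := by
  refine contDiff_iff_contDiffAt.2 fun ξ => ?_
  by_cases hξ' : ξ ∈ tsupport ψ
  swap
  · refine (contDiffAt_const (c := (0 : ℂ))).congr_of_eventuallyEq ?_
    filter_upwards [notMem_tsupport_iff_eventuallyEq.1 hξ'] with η hη
    simp [unheated, hη]
  have h0 : ξ ≠ 0 := fun h => hψ.zero_notMem (h ▸ hξ')
  refine hψ.smooth.contDiffAt.mul (Complex.ofRealCLM.contDiff.contDiffAt.comp ξ ?_)
  refine (ContDiffAt.rpow_const_of_ne ?_ ?_).exp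
  · exact contDiffAt_const.mul (contDiffAt_norm ℝ h0)
  · have : 0 < ‖ξ‖ := norm_pos_iff.2 h0
    positivity

lemma unheated_hasCompactSupport (α : ℝ) {ψ : Sp n → ℂ} (hψ : IsDyadicPartition ψ) :
    HasCompactSupport (unheated α ψ) := hψ.compact_support.mul_right

/-- At time c ^ (2α) the heat symbol at ξ is that of time 1 at c • ξ, so it cancels the exponential
in `unheated`. -/
lemma cv_unheated {α : ℝ} (hα : 0 < α) (hα' : α < 1) {ψ : Sp n → ℂ} (hψ : IsDyadicPartition ψ)
    {c : ℝ} (hc : 0 < c) :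
    cv (𝓕⁻ (fun ξ => unheated α ψ (c • ξ))) (heatKernel α (c ^ (2 * α))) =
      𝓕⁻ (fun ξ => ψ (c • ξ)) := by
  have h1 := contDiff_dilate (unheated_contDiff α hψ) c
  have h2 := hasCompactSupport_dilate (unheated_hasCompactSupport α hψ) hc.ne'
  ext x
  rw [heatKernel, cv_fourierInv (integrable_of_test h1 h2).2
    (integrable_heatSymbol hα hα' (by positivity)), fourier_fourierInv_of_test h1 h2]
  refine congrArg (fun f : Sp n → ℂ => 𝓕⁻ f x) (funext fun ξ => ?_)
  simp only [unheated, heatSymbol]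
  rw [mul_assoc, ← Complex.ofReal_mul, ← Real.exp_add, norm_smul,
    Real.norm_of_nonneg hc.le, show 2 * Real.pi * (c * ‖ξ‖) = c * (2 * Real.pi * ‖ξ‖) by ring,
    Real.mul_rpow hc.le (by positivity)]
  simp

/-- Factor ψ(cD) = a(cD) S(c ^ (2α)); the kernel of a(cD) has an L¹ norm independent of c. -/
lemma norm_cv_dyadic_le {α : ℝ} (hα : 0 < α) (hα' : α < 1) {ψ : Sp n → ℂ}
    (hψ : IsDyadicPartition ψ) {c : ℝ} (hc : 0 < c) {f : Sp n → ℂ} {B L : ℝ}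
    (hf : AEStronglyMeasurable f) (hB : ∀ᵐ x, ‖f x‖ ≤ B)
    (hL : ∀ᵐ x, ‖cv (heatKernel α (c ^ (2 * α))) f x‖ ≤ L) (x : Sp n) :
    ‖cv (𝓕⁻ (fun ξ => ψ (c • ξ))) f x‖ ≤ (∫ y, ‖𝓕⁻ (unheated α ψ) y‖) * L := by
  have h1 := contDiff_dilate (unheated_contDiff α hψ) c
  have h2 := hasCompactSupport_dilate (unheated_hasCompactSupport α hψ) hc.ne'
  obtain ⟨h3, h4⟩ := integrable_of_test h1 h2
  have ht : 0 < c ^ (2 * α) := by positivity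
  rw [← cv_unheated hα hα' hψ hc, ← cv_cv h4 (continuous_fourierInv h3)
    (integrable_heatKernel hα hα' ht) (continuous_heatKernel hα hα' ht) hf hB,
    ← integral_norm_fourierInv_dilate (unheated α ψ) hc]
  exact norm_cv_le h4 hL x

/-- At scale 2 ^ (-j) the heat time is 2 ^ (-2αj), and t ^ (-β) = 2 ^ (j(2α - 1)) cancels the Besov
weight exactly. -/
theorem besovNorm_le {α : ℝ} (hα : 1 / 2 < α) (hα' : α < 1) {ψ : Sp n → ℂ}
    (hψ : IsDyadicPartition ψ) {f : Sp n → ℂ} {A B : ℝ}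
    (hf : AEStronglyMeasurable f) (hB : ∀ᵐ x, ‖f x‖ ≤ B)
    (hA : ∀ t : ℝ, 0 < t → ∀ᵐ x, ‖cv (heatKernel α t) f x‖ ≤ A * t ^ (-decayExp α))
    {v : 𝓢'(Sp n, ℂ)} (hv : Represents f v) :
    besovNorm ψ (1 - 2 * α) v ≤ ENNReal.ofReal ((∫ y, ‖𝓕⁻ (unheated α ψ) y‖) * A) := by
  have hα0 : 0 < α := by linarith
  refine iSup_le fun j => ?_
  set c : ℝ := (2 : ℝ) ^ (-j) with hc
  have hc0 : 0 < c := by positivity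
  have h1 := contDiff_dilate hψ.smooth c
  have h2 := hasCompactSupport_dilate hψ.compact_support hc0.ne'
  obtain ⟨h3, h4⟩ := integrable_of_test h1 h2
  have hrep := represents_fourierMultiplier hf hB hv (h2.hasTemperateGrowth h1) h3 h4
  have hle := linftyNorm_le_of_represents hrep
    (aestronglyMeasurable_cv (continuous_fourierInv h3) hf)
    (.of_forall fun x => norm_cv_dyadic_le hα0 hα' hψ hc0 hf hB (hA _ (by positivity)) x)
  refine (mul_le_mul_right hle _).trans ?_
  rw [← ENNReal.ofReal_mul (by positivity)]
  refine le_of_eq (congrArg _ ?_)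
  have hpow : (2 : ℝ) ^ ((j : ℝ) * (1 - 2 * α)) * (c ^ (2 * α)) ^ (-decayExp α) = 1 := by
    rw [hc, ← Real.rpow_intCast, ← Real.rpow_mul two_pos.le, ← Real.rpow_mul two_pos.le,
      ← Real.rpow_add two_pos]
    have : (j : ℝ) * (1 - 2 * α) + ((-j : ℤ) : ℝ) * (2 * α) * -decayExp α = 0 := by
      unfold decayExp; push_cast; field_simp; ring
    rw [this, Real.rpow_zero]
  calc _ = ((∫ y, ‖𝓕⁻ (unheated α ψ) y‖) * A) *
        ((2 : ℝ) ^ ((j : ℝ) * (1 - 2 * α)) * (c ^ (2 * α)) ^ (-decayExp α)) := by ring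
    _ = _ := by rw [hpow, mul_one]

/-! ### Low frequencies -/

/-- The `L¹` modulus of continuity. -/
def modulus (κ : Sp n → ℂ) (h : Sp n) : ℝ := ∫ x, ‖κ x - κ (x - h)‖

lemma tendsto_modulus (κ : 𝓢(Sp n, ℂ)) : Tendsto (modulus κ) (𝓝 0) (𝓝 0) := by
  -- Decay of order n + 1 suffices for an integrable majorant in dimension n.
  set r : ℕ := n + 1
  set C : ℝ := 2 ^ r * ((Finset.Iic (r, 0)).sup (fun m => SchwartzMap.seminorm ℝ m.1 m.2)) κ with hC
  have hdec : ∀ x, (1 + ‖x‖) ^ r * ‖κ x‖ ≤ C := by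
    intro x
    have := SchwartzMap.one_add_le_sup_seminorm_apply (𝕜 := ℝ) (m := (r, 0)) (k := r) (n := 0)
      le_rfl le_rfl κ x
    rwa [norm_iteratedFDeriv_zero] at this
  have hC0 : 0 ≤ C := le_trans (by positivity) (hdec 0)
  have hint : Integrable (fun x : Sp n => (C + C * 2 ^ r) * (1 + ‖x‖) ^ (-(r : ℝ))) := by
    refine (integrable_one_add_norm ?_).const_mul _
    rw [finrank_euclideanSpace_fin]; simp [r]
  have h := tendsto_integral_filter_of_dominated_convergence (μ := (volume : Measure (Sp n)))
    (l := 𝓝 (0 : Sp n)) (F := fun h x => ‖κ x - κ (x - h)‖) (f := fun _ => 0)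
    (fun x : Sp n => (C + C * 2 ^ r) * (1 + ‖x‖) ^ (-(r : ℝ))) ?_ ?_ hint ?_
  · rw [show modulus κ = fun h => ∫ x, ‖κ x - κ (x - h)‖ from rfl]
    simpa using h
  · refine .of_forall fun h => Continuous.aestronglyMeasurable ?_
    have := κ.continuous
    fun_prop
  · filter_upwards [Metric.ball_mem_nhds (0 : Sp n) one_pos] with h hh
    refine .of_forall fun x => ?_
    have hh' : ‖h‖ < 1 := by simpa using hh
    rw [norm_norm, Real.rpow_neg (by positivity), Real.rpow_natCast]
    have h1 : ‖κ x‖ ≤ C * ((1 + ‖x‖) ^ r)⁻¹ := by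
      rw [← div_eq_mul_inv, le_div_iff₀ (by positivity)]
      linarith [hdec x]
    have h2 : ‖κ (x - h)‖ ≤ C * 2 ^ r * ((1 + ‖x‖) ^ r)⁻¹ := by
      rw [← div_eq_mul_inv, le_div_iff₀ (by positivity)]
      have h3 : 1 + ‖x‖ ≤ 2 * (1 + ‖x - h‖) := by
        have := norm_sub_norm_le x h
        have := norm_nonneg (x - h)
        linarith
      calc ‖κ (x - h)‖ * (1 + ‖x‖) ^ r ≤ ‖κ (x - h)‖ * (2 * (1 + ‖x - h‖)) ^ r := by gcongr
        _ = ((1 + ‖x - h‖) ^ r * ‖κ (x - h)‖) * 2 ^ r := by rw [mul_pow]; ring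
        _ ≤ C * 2 ^ r := by gcongr; exact hdec _
    calc _ ≤ ‖κ x‖ + ‖κ (x - h)‖ := norm_sub_le _ _
      _ ≤ _ := by rw [add_mul]; exact add_le_add h1 h2
  · refine .of_forall fun x => ?_
    have : Continuous fun h => ‖κ x - κ (x - h)‖ := by
      have := κ.continuous
      fun_prop
    simpa using this.tendsto 0

lemma modulus_le {κ : Sp n → ℂ} (hκ : Integrable κ) (h : Sp n) :
    modulus κ h ≤ 2 * ∫ x, ‖κ x‖ := by
  have h2 := hκ.comp_sub_right h
  calc modulus κ h ≤ ∫ x, (‖κ x‖ + ‖κ (x - h)‖) :=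
        integral_mono (hκ.sub h2).norm (hκ.norm.add h2.norm) fun x => norm_sub_le _ _
    _ = _ := by
        rw [integral_add hκ.norm h2.norm, integral_sub_right_eq_self (fun x => ‖κ x‖) h]; ring

lemma modulus_nonneg (κ : Sp n → ℂ) (h : Sp n) : 0 ≤ modulus κ h :=
  integral_nonneg fun _ => norm_nonneg _

lemma measurable_modulus {κ : Sp n → ℂ} (hκ : Continuous κ) : Measurable (modulus κ) := by
  have h : StronglyMeasurable (fun p : Sp n × Sp n => ‖κ p.2 - κ (p.2 - p.1)‖) :=
    Continuous.stronglyMeasurable (by fun_prop)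
  exact h.integral_prod_right'.measurable

lemma modulus_dilate (g : Sp n → ℂ) {c : ℝ} (hc : 0 < c) (h : Sp n) :
    modulus (𝓕⁻ (fun ξ => g (c • ξ))) h = modulus (𝓕⁻ g) (c⁻¹ • h) := by
  have h1 := integral_norm_comp_dilate (fun x => 𝓕⁻ g x - 𝓕⁻ g (x - c⁻¹ • h)) (inv_pos.2 hc)
  rw [modulus, modulus]
  simp_rw [fourierInv_comp_smul g hc, ← mul_sub, norm_mul, Complex.norm_real, smul_sub]
  rw [integral_const_mul, h1,
    Real.norm_of_nonneg (by positivity), inv_pow, inv_inv, inv_mul_cancel_left₀ (by positivity)]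

lemma norm_cv_sub_cv_le {k f : Sp n → ℂ} {B : ℝ} (hk : Integrable k) (hf : AEStronglyMeasurable f)
    (hB : ∀ᵐ x, ‖f x‖ ≤ B) (x y : Sp n) : ‖cv k f x - cv k f (x - y)‖ ≤ modulus k y * B := by
  have h1 : Integrable (fun z => k z - k (z - y)) := hk.sub (hk.comp_sub_right y)
  have h2 : cv k f x - cv k f (x - y) = cv (fun z => k z - k (z - y)) f x := by
    rw [cv, cv, cv, ← integral_sub (integrable_cv hk hf hB x) (integrable_cv hk hf hB (x - y))]
    congr 1; ext z
    rw [sub_right_comm x z y]; ring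
  rw [h2]
  exact norm_cv_le h1 hB x

/-- Split f = S(t)f + (f - S(t)f). As the heat kernel has integral 1, the second part is an average
of differences of θ(cD)f, controlled by the L¹ modulus of continuity of its kernel, evaluated at y /
c after rescaling. The convolutions commute because their symbols do. -/
lemma norm_cv_lowFrequency_le {α : ℝ} (hα : 0 < α) (hα' : α < 1) {g : Sp n → ℂ}
    (hg : ContDiff ℝ (⊤ : ℕ∞) g) (hgc : HasCompactSupport g) {c t : ℝ} (hc : 0 < c) (ht : 0 < t)
    {f : Sp n → ℂ} {B L : ℝ} (hf : AEStronglyMeasurable f) (hB : ∀ᵐ x, ‖f x‖ ≤ B)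
    (hL : ∀ᵐ x, ‖cv (heatKernel α t) f x‖ ≤ L) (x : Sp n) :
    ‖cv (𝓕⁻ (fun ξ => g (c • ξ))) f x‖ ≤ (∫ y, ‖𝓕⁻ g y‖) * L +
      (∫ y : Sp n, ‖heatKernel α t y‖ * modulus (𝓕⁻ g) (c⁻¹ • y)) * B := by
  have h1 := contDiff_dilate hg c
  have h2 := hasCompactSupport_dilate hgc hc.ne'
  obtain ⟨h3, h4⟩ := integrable_of_test h1 h2
  obtain ⟨h3', h4'⟩ := integrable_of_test hg hgc
  have hkc := continuous_fourierInv h3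
  have hΦ := integrable_heatKernel (n := n) hα hα' ht
  have hΦc := continuous_heatKernel (n := n) hα hα' ht
  set k := 𝓕⁻ (fun ξ => g (c • ξ)) with hk
  have hcomm : cv k (heatKernel α t) = cv (heatKernel α t) k := by
    ext y
    rw [hk, cv_fourierInv hΦ h3, fourier_heatKernel hα hα' ht, heatKernel.eq_1 α t,
      cv_fourierInv h4 (integrable_heatSymbol hα hα' ht), fourier_fourierInv_of_test h1 h2]
    refine congrArg (fun f : Sp n → ℂ => 𝓕⁻ f y) (funext fun ξ => mul_comm _ _)
  have hF : ∀ y, ‖cv k f y‖ ≤ (∫ z, ‖k z‖) * B := norm_cv_le h4 hB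
  have hFm : AEStronglyMeasurable (cv k f) := aestronglyMeasurable_cv hkc hf
  have hsplit : cv k f x = cv k (cv (heatKernel α t) f) x +
      ∫ y, heatKernel α t y * (cv k f x - cv k f (x - y)) := by
    have e1 : cv k (cv (heatKernel α t) f) x = cv (heatKernel α t) (cv k f) x := by
      rw [cv_cv h4 hkc hΦ hΦc hf hB, cv_cv hΦ hΦc h4 hkc hf hB, hcomm]
    have e2 : Integrable (fun y => heatKernel α t y * cv k f (x - y)) := by
      have := (integrable_cv hΦ hFm (.of_forall hF) x).comp_sub_left x
      simpa using this
    rw [e1, cv_eq_swap (heatKernel α t) (cv k f) x]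
    simp_rw [mul_sub]
    rw [integral_sub (hΦ.mul_const _) e2, integral_mul_const, integral_heatKernel hα hα' ht]
    ring
  have hdom : Integrable (fun y : Sp n => ‖heatKernel α t y‖ * modulus (𝓕⁻ g) (c⁻¹ • y)) := by
    refine hΦ.norm.mul_bdd (c := 2 * ∫ x, ‖𝓕⁻ g x‖)
      ((measurable_modulus (continuous_fourierInv h3')).comp
        (by fun_prop : Measurable fun y : Sp n => c⁻¹ • y)).aestronglyMeasurable
      (.of_forall fun y => ?_)
    rw [Real.norm_of_nonneg (modulus_nonneg _ _)]
    exact modulus_le h4' _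
  rw [hsplit]
  refine (norm_add_le _ _).trans (add_le_add ?_ ?_)
  · rw [← integral_norm_fourierInv_dilate g hc]
    exact norm_cv_le h4 hL x
  · rw [← integral_mul_const]
    refine norm_integral_le_of_norm_le (hdom.mul_const B) (.of_forall fun y => ?_)
    rw [norm_mul, mul_assoc, ← modulus_dilate g hc]
    exact mul_le_mul_of_nonneg_left (norm_cv_sub_cv_le h4 hf hB x y) (norm_nonneg _)

theorem vanishesAtLowFrequency {α : ℝ} (hα : 1 / 2 < α) (hα' : α < 1) {f : Sp n → ℂ} {A B : ℝ}
    (hf : AEStronglyMeasurable f) (hB : ∀ᵐ x, ‖f x‖ ≤ B)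
    (hA : ∀ t : ℝ, 0 < t → ∀ᵐ x, ‖cv (heatKernel α t) f x‖ ≤ A * t ^ (-decayExp α))
    {v : 𝓢'(Sp n, ℂ)} (hv : Represents f v) : VanishesAtLowFrequency v := by
  have hα0 : 0 < α := by linarith
  intro θ hθ hθc
  obtain ⟨hi, hi'⟩ := integrable_of_test hθ hθc
  have hle : ∀ l : ℝ, 0 < l → ∀ t : ℝ, 0 < t → linftyNorm
      (TemperedDistribution.fourierMultiplierCLM ℂ (fun ξ : Sp n => θ (l • ξ)) v) ≤
      ENNReal.ofReal ((∫ y, ‖𝓕⁻ θ y‖) * (A * t ^ (-decayExp α)) +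
      (∫ y : Sp n, ‖heatKernel α t y‖ * modulus (𝓕⁻ θ) (l⁻¹ • y)) * B) := by
    intro l hl t ht
    have h1 := contDiff_dilate hθ l
    have h2 := hasCompactSupport_dilate hθc hl.ne'
    obtain ⟨h3, h4⟩ := integrable_of_test h1 h2
    exact linftyNorm_le_of_represents
      (represents_fourierMultiplier hf hB hv (h2.hasTemperateGrowth h1) h3 h4)
      (aestronglyMeasurable_cv (continuous_fourierInv h3) hf)
      (.of_forall fun x => norm_cv_lowFrequency_le hα0 hα' hθ hθc hl ht hf hB (hA t ht) x)
  have hlim1 : Tendsto (fun t : ℝ => (∫ y, ‖𝓕⁻ θ y‖) * (A * t ^ (-decayExp α))) atTop (𝓝 0) := by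
    have := ((tendsto_rpow_neg_atTop (decayExp_pos hα)).const_mul A).const_mul (∫ y, ‖𝓕⁻ θ y‖)
    simpa using this
  have hlim2 : ∀ t : ℝ, 0 < t → Tendsto (fun l : ℝ =>
      (∫ y : Sp n, ‖heatKernel α t y‖ * modulus (𝓕⁻ θ) (l⁻¹ • y)) * B) atTop (𝓝 0) := by
    intro t ht
    have hΦ := integrable_heatKernel (n := n) hα0 hα' ht
    have hmod : Tendsto (modulus (𝓕⁻ θ)) (𝓝 0) (𝓝 0) := by
      have := tendsto_modulus (𝓕⁻ (hθc.toSchwartzMap hθ))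
      rwa [SchwartzMap.fourierInv_coe] at this
    have h := tendsto_integral_filter_of_dominated_convergence (μ := (volume : Measure (Sp n)))
      (l := (atTop : Filter ℝ))
      (F := fun l y => ‖heatKernel α t y‖ * modulus (𝓕⁻ θ) (l⁻¹ • y)) (f := fun _ => 0)
      (fun y => ‖heatKernel α t y‖ * (2 * ∫ x, ‖𝓕⁻ θ x‖)) ?_ ?_ (hΦ.norm.mul_const _) ?_
    · simpa using h.mul_const B
    · refine .of_forall fun l => hΦ.norm.aestronglyMeasurable.mul ?_
      exact ((measurable_modulus (continuous_fourierInv hi)).comp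
        (by fun_prop : Measurable fun y : Sp n => l⁻¹ • y)).aestronglyMeasurable
    · refine .of_forall fun l => .of_forall fun y => ?_
      rw [norm_mul, norm_norm, Real.norm_of_nonneg (modulus_nonneg _ _)]
      exact mul_le_mul_of_nonneg_left (modulus_le hi' _) (norm_nonneg _)
    · refine .of_forall fun y => ?_
      have h1 : Tendsto (fun l : ℝ => l⁻¹ • y) atTop (𝓝 0) := by
        simpa using (tendsto_inv_atTop_zero (𝕜 := ℝ)).smul_const y
      simpa using (hmod.comp h1).const_mul ‖heatKernel α t y‖
  refine ENNReal.tendsto_nhds_zero.2 fun ε hε => ?_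
  obtain ⟨δ, hδ, hδε⟩ : ∃ δ : ℝ, 0 < δ ∧ ENNReal.ofReal δ ≤ ε := by
    rcases eq_or_ne ε ⊤ with rfl | htop
    · exact ⟨1, one_pos, le_top⟩
    · exact ⟨ε.toReal, ENNReal.toReal_pos hε.ne' htop, ENNReal.ofReal_toReal_le⟩
  -- The order matters: t is fixed first, by a bound uniform in λ; only then does λ → ∞ make the
  -- second term small.
  obtain ⟨t, ht, ht0⟩ := ((hlim1.eventually (gt_mem_nhds (half_pos hδ))).and
    (eventually_gt_atTop 0)).exists
  filter_upwards [(hlim2 t ht0).eventually (gt_mem_nhds (half_pos hδ)), eventually_gt_atTop 0]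
    with l hl hl0
  exact ((hle l hl0 t ht0).trans (ENNReal.ofReal_le_ofReal (by linarith))).trans hδε

/-! ### The Carleson norm -/

/-- Reconciles the distributional convention of `IsHeatFlow` with ordinary convolution: the
translations have opposite signs, which evenness of the kernel absorbs. -/
lemma isHeatFlow_cv {α : ℝ} (hα : 0 < α) (hα' : α < 1) {f : Sp n → ℂ} {B : ℝ}
    (hf : AEStronglyMeasurable f) (hB : ∀ᵐ x, ‖f x‖ ≤ B) {v : 𝓢'(Sp n, ℂ)}
    (hv : Represents f v) : IsHeatFlow α v (fun t => cv (heatKernel α t) f) := by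
  intro t ht φ
  have hΦ := integrable_heatKernel (n := n) hα hα' ht
  have hΦc := continuous_heatKernel (n := n) hα hα' ht
  have hval : ∀ z, v (compSubConstCLM ℂ z φ) = ∫ y, compSubConstCLM ℂ z φ y * f y := fun z =>
    (hv _).2
  refine ⟨?_, integrable_schwartz_mul φ (aestronglyMeasurable_cv hΦc hf)
    (.of_forall fun x => norm_cv_le hΦ hB x), ?_⟩
  · have h := (integrable_test_cv φ hΦ hf hB).integral_prod_left.comp_neg
    refine h.congr (.of_forall fun z => ?_)
    simp only
    rw [hval, ← integral_const_mul]
    congr 1; ext y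
    rw [heatKernel_neg hα hα' ht, compSubConstCLM_apply, neg_add_eq_sub]; ring
  · rw [integral_test_cv φ hΦ hf hB, ← integral_neg_eq_self]
    congr 1; ext z
    rw [heatKernel_neg hα hα' ht, neg_neg, hval]

/-- The constant in the Carleson bound. -/
def carlesonConst (n : ℕ) (α : ℝ) : ℝ :=
  √((volume (Metric.ball (0 : Sp n) 1)).toReal / (1 - 2 * decayExp α))

/-- The squared decay t ^ (-2β) is integrable at 0, and the cylinder contributes R ^ n times R ^
(2α(1 - 2β)) = R ^ (2 - 2α), exactly the normalising power. -/
theorem carlesonNorm_le {α : ℝ} (hα : 1 / 2 < α) (hα' : α < 1) {f : Sp n → ℂ} {A B : ℝ}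
    (hf : AEStronglyMeasurable f) (hB : ∀ᵐ x, ‖f x‖ ≤ B) (hA0 : 0 ≤ A)
    (hA : ∀ t : ℝ, 0 < t → ∀ᵐ x, ‖cv (heatKernel α t) f x‖ ≤ A * t ^ (-decayExp α))
    {v : 𝓢'(Sp n, ℂ)} (hv : Represents f v) :
    carlesonNorm α v ≤ ENNReal.ofReal (carlesonConst n α * A) := by
  have hα0 : 0 < α := by linarith
  have hβ := two_mul_decayExp_lt_one hα0 hα'
  -- The norm is an infimum over flows, so exhibiting the convolution flow is enough.
  refine (iInf₂_le _ (isHeatFlow_cv hα0 hα' hf hB hv)).trans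
    (iSup_le fun x => iSup_le fun R => iSup_le fun hR => ?_)
  set V : ℝ := (volume (Metric.ball (0 : Sp n) 1)).toReal with hV
  have hV0 : 0 ≤ V := ENNReal.toReal_nonneg
  have hball : volume (Metric.ball x R) = ENNReal.ofReal (R ^ n * V) := by
    rw [Measure.addHaar_ball_of_pos _ _ hR, finrank_euclideanSpace_fin,
      ENNReal.ofReal_mul (by positivity), hV, ENNReal.ofReal_toReal measure_ball_lt_top.ne]
  have hT : 0 < R ^ (2 * α) := by positivity
  have hinner : ∀ t : ℝ, 0 < t → ∫⁻ y in Metric.ball x R, ‖cv (heatKernel α t) f y‖ₑ ^ 2 ≤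
      ENNReal.ofReal (A ^ 2 * (R ^ n * V) * t ^ (-(2 * decayExp α))) := by
    intro t ht
    have hp : (A * t ^ (-decayExp α)) ^ 2 = A ^ 2 * t ^ (-(2 * decayExp α)) := by
      rw [mul_pow, ← Real.rpow_natCast (t ^ (-decayExp α)), ← Real.rpow_mul ht.le]
      congr 2; push_cast; ring
    calc _ ≤ ∫⁻ y in Metric.ball x R, ENNReal.ofReal ((A * t ^ (-decayExp α)) ^ 2) := by
          refine lintegral_mono_ae (ae_restrict_of_ae ?_)
          filter_upwards [hA t ht] with y hy
          rw [← ofReal_norm, ← ENNReal.ofReal_pow (norm_nonneg _)]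
          refine ENNReal.ofReal_le_ofReal ?_
          gcongr
      _ = _ := by
          rw [lintegral_const, Measure.restrict_apply_univ, hball,
            ← ENNReal.ofReal_mul (by positivity), hp]
          congr 1; ring
  obtain ⟨hI1, hI2⟩ := integrableOn_rpow_neg hβ hT
  have houter : ∫⁻ t in Set.Ioo 0 (R ^ (2 * α)), ∫⁻ y in Metric.ball x R,
      ‖cv (heatKernel α t) f y‖ₑ ^ 2 ≤
      ENNReal.ofReal (A ^ 2 * (R ^ n * V) * ((R ^ (2 * α)) ^ (1 - 2 * decayExp α) /
        (1 - 2 * decayExp α))) := by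
    rw [← hI2, ← integral_const_mul]
    rw [ofReal_integral_eq_lintegral_ofReal (hI1.const_mul _)]
    · exact setLIntegral_mono' measurableSet_Ioo fun t ht => hinner t ht.1
    · refine (ae_restrict_iff' measurableSet_Ioo).2 (.of_forall fun t ht => ?_)
      have := ht.1
      simp only [Pi.zero_apply]; positivity
  have hpow : R ^ (-((n : ℝ) + 2 - 2 * α)) * (R ^ n * (R ^ (2 * α)) ^ (1 - 2 * decayExp α)) = 1 := by
    rw [← Real.rpow_natCast R n, ← Real.rpow_mul hR.le, ← Real.rpow_add hR, ← Real.rpow_add hR]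
    have : -((n : ℝ) + 2 - 2 * α) + ((n : ℝ) + 2 * α * (1 - 2 * decayExp α)) = 0 := by
      unfold decayExp; field_simp; ring
    rw [this, Real.rpow_zero]
  have hbd : ENNReal.ofReal (R ^ (-((n : ℝ) + 2 - 2 * α))) *
      (∫⁻ t in Set.Ioo 0 (R ^ (2 * α)), ∫⁻ y in Metric.ball x R, ‖cv (heatKernel α t) f y‖ₑ ^ 2) ≤
      ENNReal.ofReal ((carlesonConst n α * A) ^ 2) := by
    refine (mul_le_mul_right houter _).trans ?_
    rw [← ENNReal.ofReal_mul (by positivity)]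
    refine le_of_eq (congrArg _ ?_)
    have h1 : 0 < 1 - 2 * decayExp α := by linarith
    rw [mul_pow, carlesonConst, Real.sq_sqrt (by positivity), ← hV]
    calc _ = A ^ 2 * V / (1 - 2 * decayExp α) * (R ^ (-((n : ℝ) + 2 - 2 * α)) *
          (R ^ n * (R ^ (2 * α)) ^ (1 - 2 * decayExp α))) := by ring
      _ = _ := by rw [hpow]; ring
  have hC0 : 0 ≤ carlesonConst n α * A := mul_nonneg (Real.sqrt_nonneg _) hA0
  refine (ENNReal.rpow_le_rpow hbd (by norm_num)).trans (le_of_eq ?_)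
  rw [ENNReal.ofReal_rpow_of_nonneg (by positivity) (by norm_num), ← Real.sqrt_eq_rpow,
    Real.sqrt_sq hC0]

end FracNS

end

/-! ### The main theorem -/

theorem corollary1 (n : ℕ) (α : ℝ) (hα : 1 / 2 < α) (hα' : α < 1)
    (ψ : FracNS.Sp n → ℂ) (hψ : FracNS.IsDyadicPartition ψ) :
    ∃ C : ℝ≥0, ∀ (u₀ : Fin n → 𝓢'(FracNS.Sp n, ℂ)) (u : ℝ → FracNS.Sp n → FracNS.Sp n),
      (∀ i, FracNS.MemBesov ψ (1 - 2 * α) (u₀ i)) →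
      FracNS.divergence u₀ = 0 →
      FracNS.MemGX α u →
      FracNS.IsMildSolution α u₀ u →
      ∀ t₀ : ℝ, 0 < t₀ → ∃ v : Fin n → 𝓢'(FracNS.Sp n, ℂ), ∀ i,
        FracNS.Represents (fun x => (u t₀ x i : ℂ)) (v i) ∧
        FracNS.MemBesov ψ (1 - 2 * α) (v i) ∧
        FracNS.besovNorm ψ (1 - 2 * α) (v i) ≤
          C * (FracNS.gxNorm α u + FracNS.gxNorm α u ^ 2) ∧
        FracNS.carlesonNorm α (v i) ≤
          C * (FracNS.gxNorm α u + FracNS.gxNorm α u ^ 2) := by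
  set P : ℝ := ∫ y, ‖𝓕⁻ (FracNS.unheated α ψ) y‖ with hP
  have hP0 : 0 ≤ P := by positivity
  set Q : ℝ := FracNS.carlesonConst n α with hQ
  have hQ0 : 0 ≤ Q := Real.sqrt_nonneg _
  set D : ℝ := FracNS.mildConst n α with hD
  have hD0 : 0 ≤ D := by
    have := FracNS.duhamelConst_nonneg (n := n) hα hα'
    rw [hD, FracNS.mildConst]; positivity
  -- P is the cost of passing from heat decay to the Besov norm, Q to the Carleson norm, and D is
  -- the constant in the heat decay of u(t₀); the sum P + Q serves both estimates.
  refine ⟨((P + Q) * D).toNNReal, fun u₀ u _ _ hu hmild t₀ ht₀ => ?_⟩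
  set M : ℝ := (FracNS.gxNorm α u).toReal with hM
  have hM0 : 0 ≤ M := ENNReal.toReal_nonneg
  have hfm := fun i => hu.coord_aestronglyMeasurable ht₀ i
  have hfb : ∀ i, ∀ᵐ x, ‖(u t₀ x i : ℂ)‖ ≤ M * t₀ ^ (-FracNS.decayExp α) := fun i => by
    filter_upwards [hu.ae_norm_le ht₀] with x hx
    exact (FracNS.norm_coord_le _ _).trans hx
  choose v hv using fun i => FracNS.exists_represents (hfm i) (hfb i)
  refine ⟨v, fun i => ?_⟩
  have hA := fun t ht => FracNS.norm_heat_mild_le hα hα' hu hmild ht₀ i (t := t) ht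
  have hrhs : (((P + Q) * D).toNNReal : ℝ≥0∞) * (FracNS.gxNorm α u + FracNS.gxNorm α u ^ 2) =
      ENNReal.ofReal ((P + Q) * D * (M + M ^ 2)) := by
    rw [ENNReal.ofReal_mul (by positivity), ENNReal.ofReal_add hM0 (by positivity),
      ENNReal.ofReal_pow hM0, hM, ENNReal.ofReal_toReal hu.norm_lt_top.ne]
    rfl
  have hbes := FracNS.besovNorm_le hα hα' hψ (hfm i) (hfb i) hA (hv i)
  refine ⟨hv i, ⟨FracNS.vanishesAtLowFrequency hα hα' (hfm i) (hfb i) hA (hv i),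
    hbes.trans_lt ENNReal.ofReal_lt_top⟩, ?_, ?_⟩
  · rw [hrhs]
    refine hbes.trans (ENNReal.ofReal_le_ofReal ?_)
    have : 0 ≤ Q * D * (M + M ^ 2) := by positivity
    calc _ = P * D * (M + M ^ 2) := by ring
      _ ≤ _ := by linarith
  · rw [hrhs]
    refine (FracNS.carlesonNorm_le hα hα' (hfm i) (hfb i) (by positivity) hA (hv i)).trans
      (ENNReal.ofReal_le_ofReal ?_)
    have : 0 ≤ P * D * (M + M ^ 2) := by positivity
    calc _ = Q * D * (M + M ^ 2) := by ring
      _ ≤ _ := by linarith
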